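/- Let $\Gamma$ be a countably infinite locally finite group (every finitely generated subgroup of $\Gamma$ is finite), equipped with a proper left-invariant metric $d$ (proper: closed bounded subsets are finite). Let $C^*_u(\Gamma)$ be its uniform Roe algebra, i.e. the norm closure in $B(\ell^2(\Gamma))$ of the $*$-algebra of operators $T$ of finite propagation, where $T$ has finite propagation if there is $R>0$ with $\langle T\delta_{x'},\delta_x\rangle=0$ whenever $d(x,x')>R$. Let $\{e\}=\Gamma_0\subseteq\Gamma_1\subseteq\Gamma_2\subseteq\cdots$ be an increasing sequence of finite subgroups of $\Gamma$ with $\Gamma=\bigcup_{n=0}^\infty\Gamma_n$, and let $k_n:=|\Gamma_n|$. Let $\ell^\infty(\mathbb N,\mathbb Z)$ be the group of bounded integer sequences $(m_1,m_2,\dots)$, with $\ell^\infty(\mathbb N,\mathbb Z)^+$ the set of those with $m_i\ge 0$ for all $i$. Define $$H_\Gamma^{(n)}:=\Big\{(m_1,m_2,\dots)\in\ell^\infty(\mathbb N,\mathbb Z):\ \sum_{i=jk_n+1}^{(j+1)k_n}m_i=0\ \text{ for all } j=0,1,2,\dots\Big\},\qquad H_\Gamma:=\bigcup_{n=0}^\infty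 H_\Gamma^{(n)},$$ which is a subgroup of $\ell^\infty(\mathbb N,\mathbb Z)$. Then there is an isomorphism of ordered abelian groups with unit $$\big(K_0(C^*_u(\Gamma)),\,K_0(C^*_u(\Gamma))^+,\,[1]_0\big)\;\cong\;\big(\ell^\infty(\mathbb N,\mathbb Z)/H_\Gamma,\ \ell^\infty(\mathbb N,\mathbb Z)^+/H_\Gamma,\ [\mathbf 1]\big),$$ that is, a group isomorphism mapping the positive cone $K_0(C^*_u(\Gamma))^+$ (the classes of projections in matrices over $C^*_u(\Gamma)$) onto the set $\ell^\infty(\mathbb N,\mathbb Z)^+/H_\Gamma$ of classes of sequences in $\ell^\infty(\mathbb N,\mathbb Z)^+$, and mapping $[1]_0$ to the class of the constant sequence $\mathbf 1=(1,1,\dots)$. -/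

import Mathlib

open scoped ENNReal Matrix

noncomputable section

namespace RoeK

/-! ### The uniform Roe algebra of a metric space -/

/-- The Hilbert space of square summable complex functions on `X`. -/
abbrev ell2 (X : Type*) : Type _ := lp (fun _ : X => ℂ) 2

open Classical in
/-- The canonical orthonormal basis vector at `x`. -/
def basisVec {X : Type*} (x : X) : ell2 X := lp.single 2 x (1 : ℂ)

/-- `T` has finite propagation: there is `R > 0` such that the matrix entry of `T` at `(x, x')`
vanishes whenever `dist x x' > R`. (Mathlib's inner product is linear in the second variable.) -/
def HasFinitePropagation {X : Type*} [MetricSpace X] (T : ell2 X →L[ℂ] ell2 X) : Prop :=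
  ∃ R : ℝ, 0 < R ∧ ∀ x x' : X, R < dist x x' → inner ℂ (basisVec x) (T (basisVec x')) = 0

theorem inner_basisVec_left {X : Type*} (x : X) (f : ell2 X) :
    inner ℂ (basisVec x) f = f x := by
  classical
  unfold basisVec
  have h := lp.inner_single_left (𝕜 := ℂ) (G := fun _ : X => ℂ) x 1 f
  simp only [RCLike.inner_apply, map_one, mul_one] at h
  convert h

theorem HasFinitePropagation.adjoint {X : Type*} [MetricSpace X] {T : ell2 X →L[ℂ] ell2 X}
    (hT : HasFinitePropagation T) : HasFinitePropagation (star T) := by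
  obtain ⟨R, hR, h⟩ := hT
  refine ⟨R, hR, fun x x' hxx => ?_⟩
  rw [ContinuousLinearMap.star_eq_adjoint, ContinuousLinearMap.adjoint_inner_right,
    ← inner_conj_symm, h x' x (by rwa [dist_comm]), map_zero]

theorem HasFinitePropagation.add {X : Type*} [MetricSpace X] {S T : ell2 X →L[ℂ] ell2 X}
    (hS : HasFinitePropagation S) (hT : HasFinitePropagation T) :
    HasFinitePropagation (S + T) := by
  obtain ⟨R, hR, h⟩ := hS
  obtain ⟨R', hR', h'⟩ := hT
  refine ⟨R + R', by positivity, fun x x' hxx => ?_⟩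
  rw [add_apply, inner_add_right, h x x' (by linarith),
    h' x x' (by linarith), add_zero]

theorem HasFinitePropagation.mul {X : Type*} [MetricSpace X] {S T : ell2 X →L[ℂ] ell2 X}
    (hS : HasFinitePropagation S) (hT : HasFinitePropagation T) :
    HasFinitePropagation (S * T) := by
  obtain ⟨R, hR, h⟩ := hS.adjoint
  obtain ⟨R', hR', h'⟩ := hT
  refine ⟨R + R', by positivity, fun x x' hxx => ?_⟩
  rw [mul_apply_eq_comp, ← ContinuousLinearMap.adjoint_inner_left,
    lp.inner_eq_tsum]
  refine (tsum_congr fun z => ?_).trans tsum_zero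
  by_cases hz : R < dist z x
  · have h1 := h z x hz
    rw [inner_basisVec_left, ContinuousLinearMap.star_eq_adjoint] at h1
    rw [h1, inner_zero_left]
  · have h1 := h' z x' (by have := dist_triangle x z x'; rw [dist_comm x z] at this; linarith)
    rw [inner_basisVec_left] at h1
    rw [h1, inner_zero_right]

theorem hasFinitePropagation_algebraMap {X : Type*} [MetricSpace X] (c : ℂ) :
    HasFinitePropagation (algebraMap ℂ (ell2 X →L[ℂ] ell2 X) c) := by
  classical
  refine ⟨1, one_pos, fun x x' hxx => ?_⟩
  have hne : x ≠ x' := by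
    rintro rfl
    rw [dist_self] at hxx
    linarith
  rw [inner_basisVec_left, Algebra.algebraMap_eq_smul_one]
  simp [basisVec, hne]

/-- The `*`-algebra of all finite propagation operators on `ℓ²(X)`. -/
def algebraicRoe (X : Type*) [MetricSpace X] : StarSubalgebra ℂ (ell2 X →L[ℂ] ell2 X) where
  carrier := {T | HasFinitePropagation T}
  mul_mem' hS hT := hS.mul hT
  add_mem' hS hT := hS.add hT
  algebraMap_mem' c := hasFinitePropagation_algebraMap c
  star_mem' hT := hT.adjoint

/-- The uniform Roe algebra: the operator norm closure of the algebra of finite propagation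
operators. -/
def uniformRoe (X : Type*) [MetricSpace X] : StarSubalgebra ℂ (ell2 X →L[ℂ] ell2 X) :=
  (algebraicRoe X).topologicalClosure

/-! ### The ordered `K₀`-group of a unital C⋆-algebra

`K₀(A)` is the Grothendieck group of the monoid of Murray-von Neumann classes of projections in
matrices over `A`; only the `*`-ring structure of `A` enters the definition. -/

/-- Murray-von Neumann equivalence of square matrices of possibly different sizes:
`p = v* v` and `q = v v*` for a rectangular matrix `v`. -/
def MvN {A : Type*} [Ring A] [StarRing A] {m n : Type*} [Fintype m] [Fintype n]
    (p : Matrix m m A) (q : Matrix n n A) : Prop :=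
  ∃ v : Matrix n m A, vᴴ * v = p ∧ v * vᴴ = q

/-- Projections in square matrices of arbitrary finite size over `A`. -/
abbrev ProjMat (A : Type*) [Ring A] [StarRing A] : Type _ :=
  Σ n : ℕ, {p : Matrix (Fin n) (Fin n) A // IsStarProjection p}

section MvNLemmas

variable {A : Type*} [Ring A] [StarRing A] {l m n o : Type*}
  [Fintype l] [Fintype m] [Fintype n] [Fintype o]

theorem MvN.refl {p : Matrix m m A} (hp : IsStarProjection p) : MvN p p := by
  refine ⟨p, ?_, ?_⟩ <;>
    rw [← Matrix.star_eq_conjTranspose, hp.isSelfAdjoint.star_eq, hp.isIdempotentElem.eq]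

theorem MvN.symm {p : Matrix m m A} {q : Matrix n n A} (h : MvN p q) : MvN q p := by
  obtain ⟨v, h1, h2⟩ := h
  exact ⟨vᴴ, by rw [Matrix.conjTranspose_conjTranspose, h2],
    by rw [Matrix.conjTranspose_conjTranspose, h1]⟩

theorem MvN.trans {p : Matrix l l A} {q : Matrix m m A} {r : Matrix n n A}
    (hp : IsStarProjection p) (hr : IsStarProjection r)
    (h : MvN p q) (h' : MvN q r) : MvN p r := by
  obtain ⟨v, h1, h2⟩ := h
  obtain ⟨w, h3, h4⟩ := h'
  refine ⟨w * v, ?_, ?_⟩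
  · calc (w * v)ᴴ * (w * v) = vᴴ * (wᴴ * w) * v := by
          rw [Matrix.conjTranspose_mul]; simp only [Matrix.mul_assoc]
      _ = (vᴴ * v) * (vᴴ * v) := by rw [h3, ← h2]; simp only [Matrix.mul_assoc]
      _ = p := by rw [h1, hp.isIdempotentElem.eq]
  · calc (w * v) * (w * v)ᴴ = w * (v * vᴴ) * wᴴ := by
          rw [Matrix.conjTranspose_mul]; simp only [Matrix.mul_assoc]
      _ = (w * wᴴ) * (w * wᴴ) := by rw [h2, ← h3]; simp only [Matrix.mul_assoc]
      _ = r := by rw [h4, hr.isIdempotentElem.eq]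

theorem MvN.fromBlocks {p : Matrix l l A} {p' : Matrix m m A} {q : Matrix n n A}
    {q' : Matrix o o A} (h : MvN p p') (h' : MvN q q') :
    MvN (Matrix.fromBlocks p 0 0 q) (Matrix.fromBlocks p' 0 0 q') := by
  obtain ⟨v, h1, h2⟩ := h
  obtain ⟨w, h3, h4⟩ := h'
  refine ⟨Matrix.fromBlocks v 0 0 w, ?_, ?_⟩ <;>
    simp [Matrix.fromBlocks_conjTranspose, Matrix.fromBlocks_multiply, h1, h2, h3, h4]

theorem MvN.reindex {p : Matrix m m A} (hp : IsStarProjection p) (e : m ≃ n) :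
    MvN p (Matrix.reindex e e p) := by
  have hs : pᴴ = p := hp.isSelfAdjoint.star_eq
  have hi : p * p = p := hp.isIdempotentElem.eq
  refine ⟨p.submatrix e.symm id, ?_, ?_⟩
  · rw [Matrix.conjTranspose_submatrix, hs, Matrix.submatrix_mul_equiv, hi, Matrix.submatrix_id_id]
  · rw [Matrix.conjTranspose_submatrix, hs, Matrix.reindex_apply]
    change p.submatrix e.symm (Equiv.refl m) * p.submatrix (Equiv.refl m) e.symm = _
    rw [Matrix.submatrix_mul_equiv, hi]

theorem MvN.blocks_comm {p : Matrix m m A} {q : Matrix n n A} (hp : IsStarProjection p)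
    (hq : IsStarProjection q) :
    MvN (Matrix.fromBlocks p 0 0 q) (Matrix.fromBlocks q 0 0 p) := by
  have hs : pᴴ = p := hp.isSelfAdjoint.star_eq
  have hi : p * p = p := hp.isIdempotentElem.eq
  have hs' : qᴴ = q := hq.isSelfAdjoint.star_eq
  have hi' : q * q = q := hq.isIdempotentElem.eq
  refine ⟨Matrix.fromBlocks 0 q p 0, ?_, ?_⟩ <;>
    simp [Matrix.fromBlocks_conjTranspose, Matrix.fromBlocks_multiply, hs, hi, hs', hi']

theorem isStarProjection_fromBlocks {p : Matrix m m A} {q : Matrix n n A}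
    (hp : IsStarProjection p) (hq : IsStarProjection q) :
    IsStarProjection (Matrix.fromBlocks p 0 0 q) := by
  have hs : pᴴ = p := hp.isSelfAdjoint.star_eq
  have hi : p * p = p := hp.isIdempotentElem.eq
  have hs' : qᴴ = q := hq.isSelfAdjoint.star_eq
  have hi' : q * q = q := hq.isIdempotentElem.eq
  refine ⟨?_, ?_⟩
  · simp [IsIdempotentElem, Matrix.fromBlocks_multiply, hi, hi']
  · simp [IsSelfAdjoint, Matrix.star_eq_conjTranspose, Matrix.fromBlocks_conjTranspose, hs, hs']

theorem isStarProjection_reindex {p : Matrix m m A} (hp : IsStarProjection p) (e : m ≃ n) :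
    IsStarProjection (Matrix.reindex e e p) := by
  have hs : pᴴ = p := hp.isSelfAdjoint.star_eq
  have hi : p * p = p := hp.isIdempotentElem.eq
  refine ⟨?_, ?_⟩
  · rw [IsIdempotentElem, Matrix.reindex_apply, Matrix.submatrix_mul_equiv, hi]
  · rw [IsSelfAdjoint, Matrix.star_eq_conjTranspose, Matrix.conjTranspose_reindex, hs]

end MvNLemmas

section Monoid

variable {A : Type*} [Ring A] [StarRing A]

/-- Murray-von Neumann equivalence on projections in matrices over `A`. -/
instance projSetoid (A : Type*) [Ring A] [StarRing A] : Setoid (ProjMat A) where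
  r p q := MvN p.2.1 q.2.1
  iseqv :=
    { refl := fun p => MvN.refl p.2.2
      symm := fun h => h.symm
      trans := fun {p _ r} h h' => MvN.trans p.2.2 r.2.2 h h' }

/-- The block diagonal sum `diag(p, q)` of two projections. -/
def ProjMat.sum (p q : ProjMat A) : ProjMat A :=
  ⟨p.1 + q.1, Matrix.reindex finSumFinEquiv finSumFinEquiv (Matrix.fromBlocks p.2.1 0 0 q.2.1),
    isStarProjection_reindex (isStarProjection_fromBlocks p.2.2 q.2.2) _⟩

theorem ProjMat.sum_mvN (p q : ProjMat A) :
    MvN (Matrix.fromBlocks p.2.1 0 0 q.2.1) (p.sum q).2.1 :=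
  MvN.reindex (isStarProjection_fromBlocks p.2.2 q.2.2) _

/-- The projection in the algebra of `0 × 0` matrices. -/
def ProjMat.zero : ProjMat A := ⟨0, 0, IsStarProjection.zero _⟩

/-- The set of Murray-von Neumann classes of projections in matrices over `A`. -/
def VMonoid (A : Type*) [Ring A] [StarRing A] : Type _ := Quotient (projSetoid A)

theorem ProjMat.sum_congr {p q p' q' : ProjMat A} (h : p ≈ p') (h' : q ≈ q') :
    p.sum q ≈ p'.sum q' := by
  have hb := isStarProjection_fromBlocks p.2.2 q.2.2
  have hb' := isStarProjection_fromBlocks p'.2.2 q'.2.2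
  exact MvN.trans (p.sum q).2.2 (p'.sum q').2.2 (p.sum_mvN q).symm
    (MvN.trans hb (p'.sum q').2.2 (MvN.fromBlocks h h') (p'.sum_mvN q'))

theorem ProjMat.sum_comm (p q : ProjMat A) : p.sum q ≈ q.sum p :=
  MvN.trans (p.sum q).2.2 (q.sum p).2.2 (p.sum_mvN q).symm
    (MvN.trans (isStarProjection_fromBlocks p.2.2 q.2.2) (q.sum p).2.2
      (MvN.blocks_comm p.2.2 q.2.2) (q.sum_mvN p))

theorem ProjMat.zero_sum (p : ProjMat A) : ProjMat.zero.sum p ≈ p := by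
  have h : MvN (Matrix.fromBlocks (0 : Matrix (Fin 0) (Fin 0) A) 0 0 p.2.1) p.2.1 := by
    have hs : p.2.1ᴴ = p.2.1 := p.2.2.isSelfAdjoint.star_eq
    have hi : p.2.1 * p.2.1 = p.2.1 := p.2.2.isIdempotentElem.eq
    refine ⟨Matrix.fromCols 0 p.2.1, ?_, ?_⟩
    · rw [Matrix.conjTranspose_fromCols_eq_fromRows_conjTranspose,
        Matrix.fromRows_mul_fromCols, hs, hi]
      simp
    · rw [Matrix.conjTranspose_fromCols_eq_fromRows_conjTranspose,
        Matrix.fromCols_mul_fromRows, hs, hi]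
      simp
  exact MvN.trans (ProjMat.zero.sum p).2.2 p.2.2 (ProjMat.zero.sum_mvN p).symm h

theorem ProjMat.sum_assoc (p q r : ProjMat A) : (p.sum q).sum r ≈ p.sum (q.sum r) := by
  have hpq := isStarProjection_fromBlocks p.2.2 q.2.2
  have hqr := isStarProjection_fromBlocks q.2.2 r.2.2
  have hl := isStarProjection_fromBlocks hpq r.2.2
  have hr := isStarProjection_fromBlocks p.2.2 hqr
  have h1 : MvN ((p.sum q).sum r).2.1
      (Matrix.fromBlocks (Matrix.fromBlocks p.2.1 0 0 q.2.1) 0 0 r.2.1) :=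
    MvN.trans ((p.sum q).sum r).2.2 hl ((p.sum q).sum_mvN r).symm
      (MvN.fromBlocks (p.sum_mvN q).symm (MvN.refl r.2.2))
  have h2 : MvN (Matrix.fromBlocks p.2.1 0 0 (Matrix.fromBlocks q.2.1 0 0 r.2.1))
      (p.sum (q.sum r)).2.1 :=
    MvN.trans hr (p.sum (q.sum r)).2.2
      (MvN.fromBlocks (MvN.refl p.2.2) (q.sum_mvN r)) (p.sum_mvN (q.sum r))
  have h3 : Matrix.reindex (Equiv.sumAssoc _ _ _) (Equiv.sumAssoc _ _ _)
      (Matrix.fromBlocks (Matrix.fromBlocks p.2.1 0 0 q.2.1) 0 0 r.2.1) =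
      Matrix.fromBlocks p.2.1 0 0 (Matrix.fromBlocks q.2.1 0 0 r.2.1) := by
    ext i j
    rcases i with i | i | i <;> rcases j with j | j | j <;> rfl
  have h4 := MvN.reindex hl (Equiv.sumAssoc _ _ _)
  rw [h3] at h4
  exact MvN.trans ((p.sum q).sum r).2.2 (p.sum (q.sum r)).2.2 h1
    (MvN.trans hl (p.sum (q.sum r)).2.2 h4 h2)

instance (A : Type*) [Ring A] [StarRing A] : Add (VMonoid A) where
  add := Quotient.map₂ ProjMat.sum fun _ _ h _ _ h' => ProjMat.sum_congr h h'

instance (A : Type*) [Ring A] [StarRing A] : Zero (VMonoid A) where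
  zero := Quotient.mk _ ProjMat.zero

/-- Classes of projections form a commutative monoid under the block diagonal sum. -/
instance (A : Type*) [Ring A] [StarRing A] : AddCommMonoid (VMonoid A) where
  add_assoc := by
    rintro ⟨p⟩ ⟨q⟩ ⟨r⟩
    exact Quotient.sound (ProjMat.sum_assoc p q r)
  zero_add := by
    rintro ⟨p⟩
    exact Quotient.sound (ProjMat.zero_sum p)
  add_zero := by
    rintro ⟨p⟩
    exact Quotient.sound (Setoid.trans (ProjMat.sum_comm p ProjMat.zero) (ProjMat.zero_sum p))
  add_comm := by
    rintro ⟨p⟩ ⟨q⟩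
    exact Quotient.sound (ProjMat.sum_comm p q)
  nsmul := nsmulRec

end Monoid

/-- The group `K₀(A)` of a unital C⋆-algebra `A`. -/
abbrev K0 (A : Type*) [Ring A] [StarRing A] : Type _ := Algebra.GrothendieckAddGroup (VMonoid A)

/-- The class `[p]₀` in `K₀(A)` of a projection `p` in `M_n(A)`. -/
def K0.cls {A : Type*} [Ring A] [StarRing A] {n : ℕ} (p : Matrix (Fin n) (Fin n) A)
    (hp : IsStarProjection p) : K0 A :=
  Algebra.GrothendieckAddGroup.of (Quotient.mk (projSetoid A) ⟨n, p, hp⟩ : VMonoid A)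

/-- The positive cone `K₀(A)⁺ = {[p]₀ : p a projection in some M_n(A)}`. -/
def K0.pos (A : Type*) [Ring A] [StarRing A] : Set (K0 A) :=
  {x | ∃ (n : ℕ) (p : Matrix (Fin n) (Fin n) A) (hp : IsStarProjection p), x = K0.cls p hp}

/-- The class `[1]₀` of the unit of `A`, viewed as a `1 × 1` matrix. -/
def K0.unit (A : Type*) [Ring A] [StarRing A] : K0 A :=
  K0.cls (1 : Matrix (Fin 1) (Fin 1) A) (IsStarProjection.one _)

/-! ### Bounded integer sequences and the subgroup `H_Γ` -/

/-- Bounded integer sequences, indexed by `0, 1, 2, …`. -/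
abbrev BddSeq : Type := lp (fun _ : ℕ => ℤ) ∞

/-- The bounded sequences whose sums over all the consecutive blocks
`[j * k, (j + 1) * k)`, `j = 0, 1, 2, …`, vanish. -/
def blockZero (k : ℕ) : AddSubgroup BddSeq where
  carrier := {m | ∀ j : ℕ, ∑ i ∈ Finset.Ico (j * k) ((j + 1) * k), m i = 0}
  zero_mem' := by
    intro j
    simp
  add_mem' := by
    intro a b ha hb j
    simp only [lp.coeFn_add, Pi.add_apply, Finset.sum_add_distrib]
    rw [ha j, hb j, add_zero]
  neg_mem' := by
    intro a ha j
    simp only [lp.coeFn_neg, Pi.neg_apply, Finset.sum_neg_distrib]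
    rw [ha j, neg_zero]

theorem blockZero_mono {k l : ℕ} (h : k ∣ l) : blockZero k ≤ blockZero l := by
  obtain ⟨c, rfl⟩ := h
  intro m hm j
  have key : ∀ d a : ℕ, ∑ i ∈ Finset.Ico (a * k) ((a + d) * k), m i = 0 := by
    intro d
    induction d with
    | zero => intro a; simp
    | succ d ih =>
      intro a
      rw [← Finset.sum_Ico_consecutive (n := (a + d) * k) _
        (Nat.mul_le_mul_right _ (by omega)) (Nat.mul_le_mul_right _ (by omega)), ih a, zero_add]
      exact hm (a + d)
  have := key c (j * c)
  rwa [show j * c * k = j * (k * c) by ring, show (j * c + c) * k = (j + 1) * (k * c) by ring]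
    at this

/-- `H_Γ`: the union over `n` of the subgroups `blockZero |Γ_n|`, for an increasing sequence
of subgroups `Γ_n`. -/
def HSub {Γ : Type*} [Group Γ] (G : ℕ → Subgroup Γ) (hG : Monotone G) : AddSubgroup BddSeq where
  carrier := ⋃ n, (blockZero (Nat.card (G n)) : Set BddSeq)
  zero_mem' := Set.mem_iUnion.2 ⟨0, zero_mem _⟩
  add_mem' := by
    intro a b ha hb
    obtain ⟨i, hi⟩ := Set.mem_iUnion.1 ha
    obtain ⟨j, hj⟩ := Set.mem_iUnion.1 hb
    refine Set.mem_iUnion.2 ⟨max i j, add_mem ?_ ?_⟩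
    · exact blockZero_mono (Subgroup.card_dvd_of_le (hG (le_max_left i j))) hi
    · exact blockZero_mono (Subgroup.card_dvd_of_le (hG (le_max_right i j))) hj
  neg_mem' := by
    intro a ha
    obtain ⟨i, hi⟩ := Set.mem_iUnion.1 ha
    exact Set.mem_iUnion.2 ⟨i, neg_mem hi⟩

end RoeK

end

/-! Left invariance gives `d(x, y) = d(1, x⁻¹y)`, and balls are finite, so an operator of finite
propagation only has entries with `x⁻¹y` in some finite subgroup `Γ_n`. It is therefore block
diagonal along the left cosets of `Γ_n`. Conversely, block diagonal operators have finite
propagation. Thus `C*_u(Γ)` is the closure of an increasing union of products of matrix algebras,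
one factor of size `k_n` for each coset of `Γ_n`.

Every projection is equivalent to a diagonal one (`exists_mvN_diagProj`). Approximate it by a block
diagonal hermitian matrix, diagonalize each block, and replace each eigenvalue by 0 or 1. The result
is within distance less than 1 of the projection up to a unitary, and such projections are
equivalent (`exists_partialIsometry_of_norm_sub_lt_one`).

A diagonal projection has a rank function on `Γ`, and two of them are equivalent exactly when, for
some `n`, their ranks have equal sums over all cosets of `Γ_n`. If the sums agree, partial
isometries chosen in each block assemble into one (`mvN_diagProj_of_sum_eq`). If the projections are
equivalent, approximating the partial isometry by a block diagonal matrix and counting dimensions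
forces equality (`exists_forall_sum_diagRank_le`).

Enumerate `Γ` so that the cosets of each `Γ_n` become the intervals of length `k_n`
(`exists_enumeration`). Rank functions become bounded nonnegative sequences, and equivalence becomes
congruence modulo `H_Γ`. The monoid of projection classes thus embeds in `ℓ^∞(ℕ, ℤ)/H_Γ` with image
the classes of nonnegative sequences. Differences of these exhaust the quotient, which is therefore
the Grothendieck group. -/

noncomputable section

namespace RoeK

/-! ### Matrix entries of operators on `ℓ²(X)` -/

section Entries

variable {X : Type*}

/-- The matrix entry of an operator on `ℓ²(X)` at `(x, y)`. -/
def ent (T : ell2 X →L[ℂ] ell2 X) (x y : X) : ℂ := T (basisVec y) x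

theorem inner_basisVec_apply (T : ell2 X →L[ℂ] ell2 X) (x y : X) :
    inner ℂ (basisVec x) (T (basisVec y)) = ent T x y :=
  inner_basisVec_left x _

open Classical in
theorem basisVec_apply (x y : X) :
    (basisVec x : ell2 X) y = if y = x then 1 else 0 := by
  by_cases h : y = x
  · subst h
    rw [if_pos rfl]
    unfold basisVec
    exact lp.single_apply_self (E := fun _ : X => ℂ) 2 y (1 : ℂ)
  · rw [if_neg h]
    unfold basisVec
    exact lp.single_apply_ne (E := fun _ : X => ℂ) 2 x (1 : ℂ) h

theorem norm_basisVec (x : X) : ‖(basisVec x : ell2 X)‖ = 1 := by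
  classical
  exact (lp.norm_single (E := fun _ : X => ℂ) (p := 2) (by norm_num) x (1 : ℂ)).trans norm_one

theorem ent_star (T : ell2 X →L[ℂ] ell2 X) (x y : X) :
    ent (star T) x y = star (ent T y x) := by
  rw [← inner_basisVec_apply, ← inner_basisVec_apply, ContinuousLinearMap.star_eq_adjoint,
    ContinuousLinearMap.adjoint_inner_right, ← inner_conj_symm]
  rfl

theorem ent_add (S T : ell2 X →L[ℂ] ell2 X) (x y : X) :
    ent (S + T) x y = ent S x y + ent T x y := rfl

theorem ent_sub (S T : ell2 X →L[ℂ] ell2 X) (x y : X) :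
    ent (S - T) x y = ent S x y - ent T x y := rfl

theorem ent_zero (x y : X) : ent (0 : ell2 X →L[ℂ] ell2 X) x y = 0 := rfl

open Classical in
theorem ent_one (x y : X) :
    ent (1 : ell2 X →L[ℂ] ell2 X) x y = if x = y then 1 else 0 :=
  basisVec_apply y x

theorem ent_smul (c : ℂ) (T : ell2 X →L[ℂ] ell2 X) (x y : X) :
    ent (c • T) x y = c * ent T x y := rfl

theorem ent_sum {ι : Type*} (s : Finset ι) (T : ι → ell2 X →L[ℂ] ell2 X) (x y : X) :
    ent (∑ i ∈ s, T i) x y = ∑ i ∈ s, ent (T i) x y := by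
  classical
  induction s using Finset.induction_on with
  | empty => simp [ent_zero]
  | insert a s ha ih => rw [Finset.sum_insert ha, Finset.sum_insert ha, ent_add, ih]

theorem norm_ent_le (T : ell2 X →L[ℂ] ell2 X) (x y : X) : ‖ent T x y‖ ≤ ‖T‖ := by
  refine (lp.norm_apply_le_norm (by norm_num) (T (basisVec y)) x).trans ?_
  simpa [norm_basisVec] using T.le_opNorm (basisVec y)

/-- An operator acts on a vector through its matrix entries. -/
theorem apply_eq_tsum (T : ell2 X →L[ℂ] ell2 X) (ξ : ell2 X) (x : X) :
    T ξ x = ∑' y, ent T x y * ξ y := by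
  have h : inner ℂ (basisVec x) (T ξ) = inner ℂ (star T (basisVec x)) ξ := by
    rw [ContinuousLinearMap.star_eq_adjoint, ContinuousLinearMap.adjoint_inner_left]
  rw [inner_basisVec_left, lp.inner_eq_tsum] at h
  rw [h]
  refine tsum_congr fun y => ?_
  have h' : (star T (basisVec x)) y = star (ent T x y) := ent_star T y x
  rw [h']
  simp [mul_comm]

theorem ext_ent {S T : ell2 X →L[ℂ] ell2 X} (h : ∀ x y, ent S x y = ent T x y) : S = T := by
  ext ξ x
  rw [apply_eq_tsum, apply_eq_tsum]
  exact tsum_congr fun y => by rw [h]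

theorem ent_mul (S T : ell2 X →L[ℂ] ell2 X) (x y : X) :
    ent (S * T) x y = ∑' z, ent S x z * ent T z y :=
  apply_eq_tsum S (T (basisVec y)) x

/-! ### Weighted permutation operators -/

theorem summable_norm_sq (ξ : ell2 X) : Summable fun x => ‖ξ x‖ ^ 2 := by
  have := (memℓp_gen_iff (p := 2) (by norm_num)).1 (lp.memℓp ξ)
  simpa using this

theorem norm_sq_eq_tsum (ξ : ell2 X) : ‖ξ‖ ^ 2 = ∑' x, ‖ξ x‖ ^ 2 := by
  have := lp.norm_rpow_eq_tsum (p := 2) (by norm_num) ξ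
  simpa using this

theorem norm_sq_weighted_le {f : X → ℂ} {C : ℝ} (hf : ∀ x, ‖f x‖ ≤ C) (σ : X ≃ X) (ξ : ell2 X)
    (x : X) : ‖f x * ξ (σ x)‖ ^ 2 ≤ C ^ 2 * ‖ξ (σ x)‖ ^ 2 := by
  rw [norm_mul, mul_pow]
  gcongr
  exact hf x

theorem summable_norm_sq_weighted {f : X → ℂ} {C : ℝ} (hf : ∀ x, ‖f x‖ ≤ C) (σ : X ≃ X)
    (ξ : ell2 X) : Summable fun x => ‖f x * ξ (σ x)‖ ^ 2 :=
  Summable.of_nonneg_of_le (fun _ => by positivity) (norm_sq_weighted_le hf σ ξ)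
    (((summable_norm_sq ξ).comp_injective σ.injective).mul_left _)

/-- The operator `ξ ↦ f · (ξ ∘ σ)` for a bounded function `f` and a permutation `σ`. -/
def weightedPerm (f : X → ℂ) (C : ℝ) (hf : ∀ x, ‖f x‖ ≤ C) (σ : X ≃ X) :
    ell2 X →L[ℂ] ell2 X :=
  LinearMap.mkContinuous
    { toFun := fun ξ => ⟨fun x => f x * ξ (σ x), memℓp_gen (by
        simpa using summable_norm_sq_weighted hf σ ξ)⟩
      map_add' := fun ξ η => by
        ext x
        exact mul_add _ _ _
      map_smul' := fun c ξ => by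
        ext x
        exact mul_left_comm _ _ _ } |C| (by
    intro ξ
    refine abs_le_of_sq_le_sq' ?_ (by positivity) |>.2
    rw [norm_sq_eq_tsum, mul_pow, sq_abs, norm_sq_eq_tsum, ← σ.tsum_eq (fun x => ‖ξ x‖ ^ 2),
      ← tsum_mul_left]
    exact Summable.tsum_le_tsum (norm_sq_weighted_le hf σ ξ) (summable_norm_sq_weighted hf σ ξ)
      (((summable_norm_sq ξ).comp_injective σ.injective).mul_left _))

theorem norm_weightedPerm_le (f : X → ℂ) (C : ℝ) (hf : ∀ x, ‖f x‖ ≤ C) (σ : X ≃ X) :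
    ‖weightedPerm f C hf σ‖ ≤ |C| :=
  LinearMap.mkContinuous_norm_le _ (abs_nonneg C) _

open Classical in
theorem ent_weightedPerm (f : X → ℂ) (C : ℝ) (hf : ∀ x, ‖f x‖ ≤ C) (σ : X ≃ X)
    (x y : X) : ent (weightedPerm f C hf σ) x y = if σ x = y then f x else 0 := by
  change f x * (basisVec y : ell2 X) (σ x) = _
  rw [basisVec_apply]
  simp

/-- A diagonal operator is multiplication by its diagonal, so a uniform estimate on eigenvalues
becomes an operator norm estimate. -/
theorem norm_le_of_ent_diagonal {T : ell2 X →L[ℂ] ell2 X} {C : ℝ} (hC : 0 ≤ C)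
    (hoff : ∀ x y, x ≠ y → ent T x y = 0) (hdiag : ∀ x, ‖ent T x x‖ ≤ C) : ‖T‖ ≤ C := by
  classical
  have : T = weightedPerm (fun x => ent T x x) C hdiag (Equiv.refl X) := by
    refine ext_ent fun x y => ?_
    rw [ent_weightedPerm]
    by_cases h : x = y
    · subst h; simp
    · simp [h, hoff x y h]
  rw [this]
  exact (norm_weightedPerm_le _ C hdiag _).trans_eq (abs_of_nonneg hC)

end Entries

/-! ### Operators that are block diagonal along the cosets of a subgroup -/

section BlockDiag

variable {Γ : Type*} [Group Γ]

/-- `T` is block diagonal with respect to the decomposition of `Γ` into left cosets of `H`. -/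
def IsBlockDiag (H : Subgroup Γ) (T : ell2 Γ →L[ℂ] ell2 Γ) : Prop :=
  ∀ x y, x⁻¹ * y ∉ H → ent T x y = 0

theorem IsBlockDiag.mono {H K : Subgroup Γ} (h : H ≤ K) {T : ell2 Γ →L[ℂ] ell2 Γ}
    (hT : IsBlockDiag H T) : IsBlockDiag K T :=
  fun x y hxy => hT x y fun h' => hxy (h h')

theorem IsBlockDiag.star {H : Subgroup Γ} {T : ell2 Γ →L[ℂ] ell2 Γ} (hT : IsBlockDiag H T) :
    IsBlockDiag H (star T) := by
  intro x y hxy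
  rw [ent_star, hT y x, star_zero]
  intro h
  exact hxy (by simpa using H.inv_mem h)

theorem IsBlockDiag.zero (H : Subgroup Γ) : IsBlockDiag H (0 : ell2 Γ →L[ℂ] ell2 Γ) :=
  fun x y _ => ent_zero x y

theorem IsBlockDiag.add {H : Subgroup Γ} {S T : ell2 Γ →L[ℂ] ell2 Γ} (hS : IsBlockDiag H S)
    (hT : IsBlockDiag H T) : IsBlockDiag H (S + T) := by
  intro x y h
  rw [ent_add, hS x y h, hT x y h, add_zero]

theorem IsBlockDiag.smul {H : Subgroup Γ} (c : ℂ) {T : ell2 Γ →L[ℂ] ell2 Γ}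
    (hT : IsBlockDiag H T) : IsBlockDiag H (c • T) := by
  intro x y h
  rw [ent_smul, hT x y h, mul_zero]

theorem IsBlockDiag.sum {H : Subgroup Γ} {ι : Type*} {s : Finset ι}
    {T : ι → ell2 Γ →L[ℂ] ell2 Γ} (hT : ∀ i, IsBlockDiag H (T i)) :
    IsBlockDiag H (∑ i ∈ s, T i) := by
  intro x y h
  rw [ent_sum]
  exact Finset.sum_eq_zero fun i _ => hT i x y h

theorem IsBlockDiag.mul {H : Subgroup Γ} {S T : ell2 Γ →L[ℂ] ell2 Γ} (hS : IsBlockDiag H S)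
    (hT : IsBlockDiag H T) : IsBlockDiag H (S * T) := by
  intro x y h
  rw [ent_mul]
  refine (tsum_congr fun z => ?_).trans tsum_zero
  by_cases hz : x⁻¹ * z ∈ H
  · rw [hT z y, mul_zero]
    intro hz'
    exact h (by simpa [mul_assoc] using H.mul_mem hz hz')
  · rw [hS x z hz, zero_mul]

/-- Row `c * g` of `S` is supported in the coset `c H`, so the series for the product collapses to a
finite sum. Only the left factor has to be block diagonal. -/
theorem IsBlockDiag.ent_mul {H : Subgroup Γ} [Fintype H] {S : ell2 Γ →L[ℂ] ell2 Γ}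
    (hS : IsBlockDiag H S) (T : ell2 Γ →L[ℂ] ell2 Γ) (c y : Γ) (g : H) :
    ent (S * T) (c * g) y = ∑ k : H, ent S (c * g) (c * k) * ent T (c * k) y := by
  classical
  have hinj : Function.Injective fun k : H => c * (k : Γ) := fun a b h =>
    Subtype.ext (mul_left_cancel h)
  rw [RoeK.ent_mul, tsum_eq_sum (s := Finset.univ.map ⟨_, hinj⟩), Finset.sum_map]
  · rfl
  · intro z hz
    rw [hS _ _ ?_, zero_mul]
    intro hmem
    refine hz (Finset.mem_map.2 ⟨⟨c⁻¹ * z, ?_⟩, Finset.mem_univ _, ?_⟩)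
    · have := H.mul_mem g.2 hmem
      simpa [mul_assoc] using this
    · simp

/-- An element of a coset, in the coordinate given by the chosen representative. -/
def cosetCoord (H : Subgroup Γ) (x : Γ) : H :=
  ⟨(QuotientGroup.mk x : Γ ⧸ H).out⁻¹ * x, QuotientGroup.leftRel_apply.1
    (Quotient.exact (Quotient.out_eq (QuotientGroup.mk x : Γ ⧸ H)))⟩

theorem out_mul_cosetCoord (H : Subgroup Γ) (x : Γ) :
    (QuotientGroup.mk x : Γ ⧸ H).out * cosetCoord H x = x := by
  simp [cosetCoord]

theorem mk_out_mul {H : Subgroup Γ} (q : Γ ⧸ H) (g : H) :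
    (QuotientGroup.mk (q.out * g) : Γ ⧸ H) = q := by
  rw [QuotientGroup.mk_mul_of_mem _ g.2, QuotientGroup.out_eq']

theorem cosetCoord_out_mul {H : Subgroup Γ} (q : Γ ⧸ H) (g : H) :
    cosetCoord H (q.out * g) = g := by
  ext
  simp only [cosetCoord]
  rw [mk_out_mul]
  simp

theorem isBlockDiag_ext {H : Subgroup Γ} {S T : ell2 Γ →L[ℂ] ell2 Γ} (hS : IsBlockDiag H S)
    (hT : IsBlockDiag H T)
    (h : ∀ (q : Γ ⧸ H) (g k : H), ent S (q.out * g) (q.out * k) = ent T (q.out * g) (q.out * k)) :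
    S = T := by
  refine ext_ent fun x y => ?_
  by_cases hxy : x⁻¹ * y ∈ H
  · have hq : (QuotientGroup.mk x : Γ ⧸ H) = QuotientGroup.mk y := QuotientGroup.eq.2 hxy
    have := h (QuotientGroup.mk x) (cosetCoord H x) (cosetCoord H y)
    rw [out_mul_cosetCoord, hq, out_mul_cosetCoord] at this
    exact this
  · rw [hS x y hxy, hT x y hxy]

/-- The block diagonal operator with prescribed uniformly bounded blocks. -/
def ofBlocks (H : Subgroup Γ) [Fintype H] (B : Γ ⧸ H → H → H → ℂ) (C : ℝ)
    (hB : ∀ q g k, ‖B q g k‖ ≤ C) : ell2 Γ →L[ℂ] ell2 Γ :=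
  -- The `h`-th summand carries the entries at the positions `(x, x * h)`. Boundedness is then
  -- automatic: this is a finite sum of bounded functions times permutations.
  ∑ h : H, weightedPerm (fun x => B (QuotientGroup.mk x) (cosetCoord H x) (cosetCoord H x * h)) C
    (fun _ => hB _ _ _) (Equiv.mulRight (h : Γ))

theorem isBlockDiag_ofBlocks (H : Subgroup Γ) [Fintype H] (B : Γ ⧸ H → H → H → ℂ) (C : ℝ)
    (hB : ∀ q g k, ‖B q g k‖ ≤ C) : IsBlockDiag H (ofBlocks H B C hB) := by
  refine IsBlockDiag.sum fun h x y hxy => ?_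
  rw [ent_weightedPerm, if_neg]
  rintro rfl
  exact hxy (by simp)

theorem ent_ofBlocks (H : Subgroup Γ) [Fintype H] (B : Γ ⧸ H → H → H → ℂ) (C : ℝ)
    (hB : ∀ q g k, ‖B q g k‖ ≤ C) (q : Γ ⧸ H) (g k : H) :
    ent (ofBlocks H B C hB) (q.out * g) (q.out * k) = B q g k := by
  classical
  rw [ofBlocks, ent_sum, Finset.sum_eq_single (g⁻¹ * k)]
  · rw [ent_weightedPerm, if_pos (by simp)]
    rw [mk_out_mul, cosetCoord_out_mul, mul_inv_cancel_left]
  · intro h _ hne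
    rw [ent_weightedPerm, if_neg]
    intro heq
    refine hne ?_
    simp only [Equiv.coe_mulRight, mul_assoc, mul_right_inj] at heq
    rw [eq_inv_mul_iff_mul_eq]
    exact Subtype.ext heq
  · simp

end BlockDiag

/-! ### Finite propagation versus block diagonality -/

section Propagation

variable {Γ : Type*} [Group Γ] [MetricSpace Γ]

theorem IsBlockDiag.hasFinitePropagation (hinv : ∀ g s t : Γ, dist (g * s) (g * t) = dist s t)
    {H : Subgroup Γ} [Finite H] {T : ell2 Γ →L[ℂ] ell2 Γ} (hT : IsBlockDiag H T) :
    HasFinitePropagation T := by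
  have := Fintype.ofFinite H
  -- The distance from `x` to `y` equals that from `1` to `x⁻¹ * y`. For an element of the finite
  -- group `H` this is at most the sum of all such distances.
  refine ⟨1 + ∑ h : H, dist 1 (h : Γ), by positivity, fun x y hxy => ?_⟩
  rw [inner_basisVec_apply]
  refine hT x y fun hmem => ?_
  rw [← hinv x⁻¹ x y, inv_mul_cancel] at hxy
  have := Finset.single_le_sum (f := fun h : H => dist 1 (h : Γ)) (fun _ _ => dist_nonneg)
    (Finset.mem_univ ⟨x⁻¹ * y, hmem⟩)
  dsimp only at this
  linarith

theorem IsBlockDiag.mem_uniformRoe (hinv : ∀ g s t : Γ, dist (g * s) (g * t) = dist s t)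
    {H : Subgroup Γ} [Finite H] {T : ell2 Γ →L[ℂ] ell2 Γ} (hT : IsBlockDiag H T) :
    T ∈ uniformRoe Γ :=
  (algebraicRoe Γ).le_topologicalClosure (hT.hasFinitePropagation hinv)

/-- If `dist x y ≤ R`, then `x⁻¹ * y` lies in the ball of radius `R` around `1`. That ball is
finite, hence contained in a single `G n`. -/
theorem exists_isBlockDiag_of_hasFinitePropagation
    (hinv : ∀ g s t : Γ, dist (g * s) (g * t) = dist s t)
    (hproper : ∀ s : Set Γ, IsClosed s → Bornology.IsBounded s → s.Finite)
    {G : ℕ → Subgroup Γ} (hmono : Monotone G) (hunion : ∀ g : Γ, ∃ n, g ∈ G n)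
    {T : ell2 Γ →L[ℂ] ell2 Γ} (hT : HasFinitePropagation T) : ∃ n, IsBlockDiag (G n) T := by
  obtain ⟨R, -, h⟩ := hT
  have hfin := hproper (Metric.closedBall 1 R) Metric.isClosed_closedBall Metric.isBounded_closedBall
  choose N hN using hunion
  obtain ⟨n, hn⟩ := (hfin.image N).bddAbove
  refine ⟨n, fun x y hxy => ?_⟩
  rw [← inner_basisVec_apply]
  refine h x y (not_le.1 fun hle => hxy ?_)
  refine hmono (hn ⟨x⁻¹ * y, ?_, rfl⟩) (hN _)
  rw [Metric.mem_closedBall, ← hinv x]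
  simpa [dist_comm] using hle

theorem exists_isBlockDiag_near
    (hinv : ∀ g s t : Γ, dist (g * s) (g * t) = dist s t)
    (hproper : ∀ s : Set Γ, IsClosed s → Bornology.IsBounded s → s.Finite)
    {G : ℕ → Subgroup Γ} (hmono : Monotone G) (hunion : ∀ g : Γ, ∃ n, g ∈ G n)
    (T : uniformRoe Γ) {ε : ℝ} (hε : 0 < ε) :
    ∃ (S : uniformRoe Γ) (n : ℕ), IsBlockDiag (G n) (S : ell2 Γ →L[ℂ] ell2 Γ) ∧ ‖T - S‖ < ε := by
  have hT : (T : ell2 Γ →L[ℂ] ell2 Γ) ∈ closure (algebraicRoe Γ : Set _) := T.2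
  obtain ⟨S, hS, hd⟩ := Metric.mem_closure_iff.1 hT ε hε
  obtain ⟨n, hn⟩ := exists_isBlockDiag_of_hasFinitePropagation hinv hproper hmono hunion hS
  refine ⟨⟨S, (algebraicRoe Γ).le_topologicalClosure hS⟩, n, hn, ?_⟩
  rw [dist_eq_norm] at hd
  exact hd

end Propagation

/-! ### Blocks of matrices over the uniform Roe algebra -/

section Blocks

variable {Γ : Type*} [Group Γ] [MetricSpace Γ] {l m n : Type*}

/-- All entries of the matrix `v` are block diagonal along the cosets of `H`. -/
def MatBlockDiag (H : Subgroup Γ) (v : Matrix m n (uniformRoe Γ)) : Prop :=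
  ∀ i j, IsBlockDiag H (v i j : ell2 Γ →L[ℂ] ell2 Γ)

/-- The block of `v` on the coset `c H`. -/
def blk (H : Subgroup Γ) (c : Γ) (v : Matrix m n (uniformRoe Γ)) : Matrix (H × m) (H × n) ℂ :=
  fun a b => ent (v a.2 b.2 : ell2 Γ →L[ℂ] ell2 Γ) (c * a.1) (c * b.1)

variable {H : Subgroup Γ}

omit [Group Γ] in
theorem coe_mul_apply [Fintype m] (v : Matrix l m (uniformRoe Γ)) (w : Matrix m n (uniformRoe Γ))
    (i : l) (j : n) : ((v * w) i j : ell2 Γ →L[ℂ] ell2 Γ) =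
      ∑ k, (v i k : ell2 Γ →L[ℂ] ell2 Γ) * (w k j : ell2 Γ →L[ℂ] ell2 Γ) := by
  rw [Matrix.mul_apply, AddSubmonoidClass.coe_finsetSum]
  rfl

theorem MatBlockDiag.mono {K : Subgroup Γ} (h : H ≤ K) {v : Matrix m n (uniformRoe Γ)}
    (hv : MatBlockDiag H v) : MatBlockDiag K v := fun i j => (hv i j).mono h

theorem MatBlockDiag.mul [Fintype m] {v : Matrix l m (uniformRoe Γ)}
    {w : Matrix m n (uniformRoe Γ)} (hv : MatBlockDiag H v) (hw : MatBlockDiag H w) :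
    MatBlockDiag H (v * w) := by
  intro i j
  rw [coe_mul_apply]
  exact IsBlockDiag.sum fun k => (hv i k).mul (hw k j)

theorem MatBlockDiag.conjTranspose {v : Matrix m n (uniformRoe Γ)} (hv : MatBlockDiag H v) :
    MatBlockDiag H vᴴ := fun i j => (hv j i).star

/-- Together with `blk_conjTranspose`, this makes restriction to a coset a `*`-homomorphism on block
diagonal matrices, so algebraic identities can be checked block by block. -/
theorem blk_mul [Fintype H] [Fintype m] {v : Matrix l m (uniformRoe Γ)}
    (hv : MatBlockDiag H v) (w : Matrix m n (uniformRoe Γ)) (c : Γ) :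
    blk H c (v * w) = blk H c v * blk H c w := by
  ext ⟨g, i⟩ ⟨k, j⟩
  rw [Matrix.mul_apply, Fintype.sum_prod_type, Finset.sum_comm]
  change ent ((v * w) i j : ell2 Γ →L[ℂ] ell2 Γ) (c * g) (c * k) = _
  rw [coe_mul_apply, ent_sum]
  exact Finset.sum_congr rfl fun _ _ => (hv _ _).ent_mul _ _ _ _

theorem blk_conjTranspose (v : Matrix m n (uniformRoe Γ)) (c : Γ) :
    blk H c vᴴ = (blk H c v)ᴴ := by
  ext ⟨g, i⟩ ⟨k, j⟩
  exact ent_star _ _ _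

theorem blk_ext {v w : Matrix m n (uniformRoe Γ)} (hv : MatBlockDiag H v) (hw : MatBlockDiag H w)
    (h : ∀ q : Γ ⧸ H, blk H q.out v = blk H q.out w) : v = w := by
  ext1 i j
  refine Subtype.ext (isBlockDiag_ext (hv i j) (hw i j) fun q g k => ?_)
  exact congrFun (congrFun (h q) (g, i)) (k, j)

/-- Blocks on different cosets are independent. The size of `H` is fixed, so a common bound on the
entries suffices to assemble any family of blocks. -/
theorem exists_blk_eq (hinv : ∀ g s t : Γ, dist (g * s) (g * t) = dist s t) [Fintype H]
    (B : Γ ⧸ H → Matrix (H × m) (H × n) ℂ) (C : ℝ) (hB : ∀ q a b, ‖B q a b‖ ≤ C) :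
    ∃ v : Matrix m n (uniformRoe Γ), MatBlockDiag H v ∧ ∀ q : Γ ⧸ H, blk H q.out v = B q := by
  refine ⟨fun i j => ⟨ofBlocks H (fun q g k => B q (g, i) (k, j)) C (fun _ _ _ => hB _ _ _),
    (isBlockDiag_ofBlocks _ _ _ _).mem_uniformRoe hinv⟩,
    fun i j => isBlockDiag_ofBlocks _ _ _ _, fun q => ?_⟩
  ext ⟨g, i⟩ ⟨k, j⟩
  exact ent_ofBlocks _ _ _ _ _ _ _

open Classical in
theorem matBlockDiag_one : MatBlockDiag H (1 : Matrix m m (uniformRoe Γ)) := by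
  intro i j
  rw [Matrix.one_apply]
  split_ifs
  · intro x y hxy
    rw [OneMemClass.coe_one, ent_one, if_neg]
    rintro rfl
    exact hxy (by simp)
  · exact IsBlockDiag.zero H

open Classical in
theorem blk_one (c : Γ) : blk H c (1 : Matrix m m (uniformRoe Γ)) = 1 := by
  ext ⟨g, i⟩ ⟨k, j⟩
  simp only [blk, Matrix.one_apply, Prod.mk.injEq]
  by_cases hij : i = j
  · simp [hij, ent_one]
  · simp [hij, ent_zero]

theorem exists_matBlockDiag_near [Finite m] [Finite n]
    (hinv : ∀ g s t : Γ, dist (g * s) (g * t) = dist s t)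
    (hproper : ∀ s : Set Γ, IsClosed s → Bornology.IsBounded s → s.Finite)
    {G : ℕ → Subgroup Γ} (hmono : Monotone G) (hunion : ∀ g : Γ, ∃ n, g ∈ G n)
    (v : Matrix m n (uniformRoe Γ)) {ε : ℝ} (hε : 0 < ε) :
    ∃ (w : Matrix m n (uniformRoe Γ)) (k : ℕ), MatBlockDiag (G k) w ∧
      ∀ i j, ‖v i j - w i j‖ < ε := by
  choose w N hN hd using fun i j =>
    exists_isBlockDiag_near hinv hproper hmono hunion (v i j) hε
  obtain ⟨k, hk⟩ := (Set.finite_range fun a : m × n => N a.1 a.2).bddAbove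
  exact ⟨w, k, fun i j => (hN i j).mono (hmono (hk ⟨(i, j), rfl⟩)), hd⟩

/-- Projections that are Murray-von Neumann equivalent in every block are equivalent. -/
theorem mvN_of_blk [Fintype m] [Fintype n] [Fintype H]
    (hinv : ∀ g s t : Γ, dist (g * s) (g * t) = dist s t)
    {p : Matrix m m (uniformRoe Γ)} {q : Matrix n n (uniformRoe Γ)} (hp : MatBlockDiag H p)
    (hq : MatBlockDiag H q) (h : ∀ c : Γ ⧸ H, MvN (blk H c.out p) (blk H c.out q)) : MvN p q := by
  choose B hB1 hB2 using h
  -- To assemble the partial isometries `B c`, their entries need a bound that does not depend on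
  -- `c`. The squared norm of column `b` is the diagonal entry of `(B c)ᴴ * B c`, a block of `p`, so
  -- it is at most the norm of an entry of `p`.
  have hbound : ∀ c a b, ‖B c a b‖ ≤ 1 + ∑ i, ‖p i i‖ := by
    intro c a b
    have h1 : ∑ k, ‖B c k b‖ ^ 2 = ‖blk H c.out p b b‖ := by
      rw [← hB1 c, Matrix.mul_apply]
      have : ∀ k, (B c)ᴴ b k * B c k b = ((‖B c k b‖ ^ 2 : ℝ) : ℂ) := fun k => by
        rw [Matrix.conjTranspose_apply, ← starRingEnd_apply, RCLike.conj_mul]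
        push_cast
        rfl
      rw [Finset.sum_congr rfl fun k _ => this k, ← Complex.ofReal_sum, Complex.norm_real,
        Real.norm_of_nonneg (by positivity)]
    have h2 : ‖B c a b‖ ^ 2 ≤ ∑ i, ‖p i i‖ :=
      calc ‖B c a b‖ ^ 2 ≤ ∑ k, ‖B c k b‖ ^ 2 :=
            Finset.single_le_sum (f := fun k => ‖B c k b‖ ^ 2) (fun _ _ => by positivity)
              (Finset.mem_univ a)
        _ ≤ ‖p b.2 b.2‖ := h1.trans_le (norm_ent_le _ _ _)
        _ ≤ ∑ i, ‖p i i‖ :=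
            Finset.single_le_sum (f := fun i => ‖p i i‖) (fun _ _ => norm_nonneg _)
              (Finset.mem_univ b.2)
    nlinarith [norm_nonneg (B c a b), sq_nonneg (‖B c a b‖ - 1)]
  obtain ⟨v, hv, hvB⟩ := exists_blk_eq hinv B _ hbound
  refine ⟨v, blk_ext (hv.conjTranspose.mul hv) hp fun c => ?_,
    blk_ext (hv.mul hv.conjTranspose) hq fun c => ?_⟩
  · rw [blk_mul hv.conjTranspose, blk_conjTranspose, hvB, hB1]
  · rw [blk_mul hv, blk_conjTranspose, hvB, hB2]

end Blocks

/-! ### Perturbation of projections in C⋆-algebras -/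

section Perturbation

/-- Projections at distance less than `1` in a C⋆-algebra are Murray-von Neumann equivalent. -/
theorem exists_partialIsometry_of_norm_sub_lt_one {B : Type*} [CStarAlgebra B] {p e : B}
    (hp : IsStarProjection p) (he : IsStarProjection e) (h : ‖p - e‖ < 1) :
    ∃ v : B, star v * v = p ∧ v * star v = e := by
  rcases subsingleton_or_nontrivial B with hB | hB
  · exact ⟨0, Subsingleton.elim _ _, Subsingleton.elim _ _⟩
  have hpp : p * p = p := hp.isIdempotentElem.eq
  have hee : e * e = e := he.isIdempotentElem.eq
  have hps : star p = p := hp.isSelfAdjoint.star_eq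
  have hes : star e = e := he.isSelfAdjoint.star_eq
  -- The square `d` commutes with `p`, and `1 - d` is positive and invertible because `‖d‖ < 1`. Its
  -- inverse square root `k` will normalize an intertwiner of `p` and `e`.
  set d := (p - e) * (p - e) with hd
  have hdsa : IsSelfAdjoint d := by
    rw [hd, IsSelfAdjoint, star_mul, star_sub, hps, hes]
  have hdexp : d = p - p * e - e * p + e := by
    rw [hd, sub_mul, mul_sub, mul_sub, hpp, hee]; abel
  have hdp : Commute d p := by
    simp only [Commute, SemiconjBy, hdexp, add_mul, sub_mul, mul_add, mul_sub, hpp, mul_assoc]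
    simp only [← mul_assoc, hpp]; abel
  have hdnorm : ‖d‖ < 1 := by
    refine (norm_mul_le _ _).trans_lt ?_
    nlinarith [norm_nonneg (p - e)]
  have hspec : ∀ t ∈ spectrum ℝ d, 0 < 1 - t := by
    intro t ht
    have := spectrum.norm_le_norm_of_mem ht
    have := le_abs_self t
    rw [← Real.norm_eq_abs] at this
    linarith
  set f : ℝ → ℝ := fun t => (√(1 - t))⁻¹ with hf
  have hcont : ContinuousOn f (spectrum ℝ d) :=
    ContinuousOn.inv₀ (by fun_prop) fun t ht => (Real.sqrt_pos.2 (hspec t ht)).ne'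
  set k := cfc f d with hk
  have hks : star k = k := (cfc_predicate f d : IsSelfAdjoint _).star_eq
  have hkp : Commute p k := (hdp.cfc_real f).symm
  have hkd : Commute d k := (Commute.refl d).cfc_real f |>.symm
  have hkk : k * (1 - d) * k = 1 := by
    have h1 : (1 - d) = cfc (fun t : ℝ => 1 - t) d := by
      rw [cfc_sub _ _ d, cfc_const_one ℝ d, cfc_id' ℝ d]
    rw [h1, hk, ← cfc_mul f (fun t : ℝ => 1 - t) d, ← cfc_mul _ f d, ← cfc_one ℝ d]
    refine cfc_congr fun t ht => ?_
    have := hspec t ht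
    have h2 := Real.mul_self_sqrt this.le
    have h3 := (Real.sqrt_pos.2 this).ne'
    simp only [hf, Pi.one_apply]
    field_simp
    rw [sq, h2]
  -- This `x` satisfies `e * x = x * p` and `star x * x = x * star x = 1 - d`. Hence `x * k` is a
  -- unitary carrying `p` to `e`, and `x * p * k` is its restriction to `p`.
  set x := e * p + (1 - e) * (1 - p) with hx
  have hxs : star x = p * e + (1 - p) * (1 - e) := by
    simp [hx, hps, hes]
  have hxx : star x * x = 1 - d := by
    rw [hxs, hx, hdexp]
    simp only [add_mul, mul_add, sub_mul, mul_sub, one_mul, mul_one, mul_assoc, hpp, hee]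
    simp only [← mul_assoc, hee]
    simp only [mul_assoc]
    abel
  have hxx' : x * star x = 1 - d := by
    rw [hxs, hx, hdexp]
    simp only [add_mul, mul_add, sub_mul, mul_sub, one_mul, mul_one, mul_assoc, hpp, hee]
    simp only [← mul_assoc, hpp]
    simp only [mul_assoc]
    abel
  have hex : e * x = x * p := by
    rw [hx]
    simp only [add_mul, mul_add, sub_mul, mul_sub, one_mul, mul_one, ← mul_assoc, hpp, hee]
    simp only [mul_assoc, hpp]
    abel
  have hxe : star x * e = p * star x := by
    have := congrArg star hex
    simpa [hps, hes] using this
  have hdk : (1 - d) * (k * k) = 1 := by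
    rw [← mul_assoc, ((Commute.one_left k).sub_left hkd).eq]
    exact hkk
  have hunit : x * (k * k) * star x = 1 := by
    have hdx : Commute (star x) d := by
      have : star x * (x * star x) = (star x * x) * star x := by rw [mul_assoc]
      rw [hxx, hxx', mul_sub, sub_mul, one_mul, mul_one] at this
      exact sub_right_injective this
    have : Commute (star x) k :=
      ((hdx.symm.cfc_real f).symm)
    rw [mul_assoc, ← (this.mul_right this).eq, ← mul_assoc, hxx', hdk]
  refine ⟨x * p * k, ?_, ?_⟩
  · calc star (x * p * k) * (x * p * k) = k * (p * (star x * x) * p) * k := by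
          simp [hps, hks, mul_assoc]
      _ = (p * k) * (1 - d) * (k * p) := by
          rw [hxx, hkp.eq, mul_assoc p, mul_assoc, mul_assoc, mul_assoc, mul_assoc, mul_assoc,
            ← hkp.eq, ← mul_assoc k p, ← hkp.eq]
      _ = p * (k * (1 - d) * k) * p := by simp only [mul_assoc]
      _ = p := by rw [hkk, mul_one, hpp]
  · calc x * p * k * star (x * p * k) = (x * p) * (k * k) * (p * star x) := by
          simp [hps, hks, mul_assoc]
      _ = e * (x * (k * k) * star x) * e := by rw [← hex, ← hxe]; simp only [mul_assoc]
      _ = e := by rw [hunit, mul_one, hee]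

variable {A : Type*} [CStarAlgebra A] {n : Type*} [Fintype n]

/-- A crude comparison: the norm of a matrix acting on the C⋆-module `A^n` is at most the sum of the
norms of its entries. It lets approximations be made entry by entry, at the cost of the factor `card
n ^ 2`. -/
theorem norm_cstarMatrix_le [PartialOrder A] [StarOrderedRing A] (M : CStarMatrix n n A) {δ : ℝ}
    (h : ∀ i j, ‖M i j‖ ≤ δ) : ‖M‖ ≤ Fintype.card n ^ 2 * δ := by
  have hle : ‖M‖ ≤ ∑ j, ∑ i, ‖M i j‖ := by
    rw [CStarMatrix.norm_def]
    refine (CStarMatrix.toCLM M).opNorm_le_bound (by positivity) fun v => ?_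
    simp only [CStarMatrix.toCLM_apply_eq_sum, Finset.sum_mul]
    apply WithCStarModule.pi_norm_le_sum_norm _ |>.trans
    gcongr with i _
    apply norm_sum_le _ _ |>.trans
    gcongr with j _
    apply norm_mul_le _ _ |>.trans
    rw [mul_comm]
    gcongr
    exact WithCStarModule.norm_apply_le_norm v j
  refine hle.trans ((Finset.sum_le_sum fun j _ => Finset.sum_le_sum fun i _ => h i j).trans_eq ?_)
  simp only [Finset.sum_const, Finset.card_univ, nsmul_eq_mul]
  ring

variable [DecidableEq n] {p a U d : Matrix n n A}

/-- An element close to a projection is nearly idempotent. -/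
theorem norm_conj_sq_sub_self_le (hp : IsStarProjection p) (hU : Uᴴ * U = 1) (hU' : U * Uᴴ = 1)
    {δ : ℝ} (hδ : Fintype.card n ^ 2 * δ ≤ 1) (h : ∀ i j, ‖(p - a) i j‖ ≤ δ) (i j : n) :
    ‖(Uᴴ * a * U * (Uᴴ * a * U) - Uᴴ * a * U) i j‖ ≤ 4 * (Fintype.card n ^ 2 * δ) := by
  -- The C⋆-norm of `CStarMatrix` is defined through an order on `A`; the spectral order supplies
  -- one.
  let _ := CStarAlgebra.spectralOrder A
  have := CStarAlgebra.spectralOrderedRing A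
  obtain ⟨P, rfl⟩ := CStarMatrix.ofMatrix.symm.surjective p
  obtain ⟨a, rfl⟩ := CStarMatrix.ofMatrix.symm.surjective a
  obtain ⟨U, rfl⟩ := CStarMatrix.ofMatrix.symm.surjective U
  replace hp : IsStarProjection P := ⟨hp.1, hp.2⟩
  replace hU : star U * U = 1 := hU
  replace hU' : U * star U = 1 := hU'
  change ‖(star U * a * U * (star U * a * U) - star U * a * U) i j‖ ≤ _
  have hx : ‖P - a‖ ≤ _ := norm_cstarMatrix_le (P - a) h
  set η := (Fintype.card n : ℝ) ^ 2 * δ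
  have hUn : ‖U‖ * ‖U‖ ≤ 1 := by
    rw [← CStarRing.norm_star_mul_self, hU]
    rcases subsingleton_or_nontrivial (CStarMatrix n n A) with h | h
    · rw [Subsingleton.elim (1 : CStarMatrix n n A) 0, norm_zero]; exact zero_le_one
    · rw [CStarRing.norm_one]
  have hPn : ‖P‖ ≤ 1 := hp.norm_le
  refine CStarMatrix.norm_entry_le_norm.trans ?_
  have h1 : star U * a * U * (star U * a * U) - star U * a * U = star U * (a * a - a) * U := by
    rw [show star U * a * U * (star U * a * U) = star U * a * (U * star U) * a * U by
      simp only [mul_assoc], hU', mul_one, mul_sub, sub_mul]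
    simp only [mul_assoc]
  -- Expand around `P`, using `P * P = P`. Each of the four terms has norm at most `η`, the
  -- quadratic one because `η ≤ 1`.
  have h2 : a * a - a = (P - a) - P * (P - a) - (P - a) * P + (P - a) * (P - a) := by
    have hPP : P * P = P := hp.isIdempotentElem.eq
    simp only [sub_mul, mul_sub, hPP]
    abel
  have h3 : ‖a * a - a‖ ≤ 4 * η := by
    have e1 := norm_mul_le P (P - a)
    have e2 := norm_mul_le (P - a) P
    have e3 := norm_mul_le (P - a) (P - a)
    have e4 : ‖P‖ * ‖P - a‖ ≤ η := by nlinarith [norm_nonneg (P - a), norm_nonneg P]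
    have e5 : ‖P - a‖ * ‖P - a‖ ≤ η := by nlinarith [norm_nonneg (P - a)]
    rw [h2]
    refine (norm_add_le _ _).trans ?_
    have e6 := norm_sub_le ((P - a) - P * (P - a)) ((P - a) * P)
    have e7 := norm_sub_le (P - a) (P * (P - a))
    linarith
  rw [h1]
  calc ‖star U * (a * a - a) * U‖ ≤ ‖star U‖ * ‖a * a - a‖ * ‖U‖ :=
        (norm_mul_le _ _).trans (by gcongr; exact norm_mul_le _ _)
    _ = (‖U‖ * ‖U‖) * ‖a * a - a‖ := by rw [norm_star]; ring
    _ ≤ 1 * ‖a * a - a‖ := by gcongr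
    _ ≤ 4 * η := by rwa [one_mul]

/-- Conjugation by the unitary `U` does not increase norms, so `p` is at distance less than 1 from
`U * d * Uᴴ`. The latter is equivalent to `d` through `d * Uᴴ`. -/
theorem mvN_of_conj_near (hp : IsStarProjection p) (hd : IsStarProjection d) (hU : Uᴴ * U = 1)
    (hU' : U * Uᴴ = 1) {δ ε : ℝ} (h : ∀ i j, ‖(p - a) i j‖ ≤ δ)
    (h' : ∀ i j, ‖(Uᴴ * a * U - d) i j‖ ≤ ε) (hlt : Fintype.card n ^ 2 * (δ + ε) < 1) :
    MvN p d := by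
  let _ := CStarAlgebra.spectralOrder A
  have := CStarAlgebra.spectralOrderedRing A
  have hdd : d * d = d := hd.isIdempotentElem.eq
  have hds : dᴴ = d := hd.isSelfAdjoint.star_eq
  have hconj : IsStarProjection (U * d * Uᴴ) := by
    refine ⟨?_, ?_⟩
    · calc U * d * Uᴴ * (U * d * Uᴴ) = U * d * (Uᴴ * U) * d * Uᴴ := by
            simp only [mul_assoc]
        _ = U * (d * d) * Uᴴ := by rw [hU, mul_one]; simp only [mul_assoc]
        _ = U * d * Uᴴ := by rw [hdd]
    · rw [IsSelfAdjoint, Matrix.star_eq_conjTranspose]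
      simp [Matrix.conjTranspose_mul, hds, mul_assoc]
  have h1 : MvN p (U * d * Uᴴ) := by
    have hn : ‖CStarMatrix.ofMatrix p - CStarMatrix.ofMatrix (U * d * Uᴴ)‖ < 1 := by
      have hUn : ‖CStarMatrix.ofMatrix U‖ * ‖CStarMatrix.ofMatrix U‖ ≤ 1 := by
        rw [← CStarRing.norm_star_mul_self]
        change ‖CStarMatrix.ofMatrix (Uᴴ * U)‖ ≤ 1
        rw [hU]
        change ‖(1 : CStarMatrix n n A)‖ ≤ 1
        rcases subsingleton_or_nontrivial (CStarMatrix n n A) with h | h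
        · rw [Subsingleton.elim (1 : CStarMatrix n n A) 0, norm_zero]; exact zero_le_one
        · rw [CStarRing.norm_one]
      have e1 := norm_cstarMatrix_le (CStarMatrix.ofMatrix p - CStarMatrix.ofMatrix a) h
      have e2 := norm_cstarMatrix_le (CStarMatrix.ofMatrix (Uᴴ * a * U - d)) h'
      have hsplit : p - U * d * Uᴴ = (p - a) + U * (Uᴴ * a * U - d) * Uᴴ := by
        have : U * (Uᴴ * a * U) * Uᴴ = a := by
          calc U * (Uᴴ * a * U) * Uᴴ = (U * Uᴴ) * a * (U * Uᴴ) := by simp only [mul_assoc]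
            _ = a := by rw [hU', one_mul, mul_one]
        rw [mul_sub, sub_mul, this]
        abel
      have e3 : ‖CStarMatrix.ofMatrix (U * (Uᴴ * a * U - d) * Uᴴ)‖ ≤
          ‖CStarMatrix.ofMatrix (Uᴴ * a * U - d)‖ := by
        set y := CStarMatrix.ofMatrix (Uᴴ * a * U - d)
        set u := CStarMatrix.ofMatrix U
        calc ‖u * y * star u‖ ≤ ‖u‖ * ‖y‖ * ‖star u‖ :=
              (norm_mul_le _ _).trans (by gcongr; exact norm_mul_le _ _)
          _ = (‖u‖ * ‖u‖) * ‖y‖ := by rw [norm_star]; ring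
          _ ≤ 1 * ‖y‖ := by gcongr
          _ = ‖y‖ := one_mul _
      calc ‖CStarMatrix.ofMatrix p - CStarMatrix.ofMatrix (U * d * Uᴴ)‖
          = ‖(CStarMatrix.ofMatrix p - CStarMatrix.ofMatrix a) +
              CStarMatrix.ofMatrix (U * (Uᴴ * a * U - d) * Uᴴ)‖ := congrArg _ hsplit
        _ ≤ _ := norm_add_le _ _
        _ ≤ Fintype.card n ^ 2 * δ + Fintype.card n ^ 2 * ε := add_le_add e1 (e3.trans e2)
        _ < 1 := by rwa [← mul_add]
    obtain ⟨v, hv1, hv2⟩ := exists_partialIsometry_of_norm_sub_lt_one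
      (p := CStarMatrix.ofMatrix p) (e := CStarMatrix.ofMatrix (U * d * Uᴴ))
      ⟨hp.1, hp.2⟩ ⟨hconj.1, hconj.2⟩ hn
    exact ⟨CStarMatrix.ofMatrix.symm v, hv1, hv2⟩
  refine h1.trans hp hd ⟨d * Uᴴ, ?_, ?_⟩
  · rw [Matrix.conjTranspose_mul, Matrix.conjTranspose_conjTranspose, hds]
    rw [mul_assoc, ← mul_assoc d, hdd, mul_assoc]
  · rw [Matrix.conjTranspose_mul, Matrix.conjTranspose_conjTranspose, hds]
    rw [mul_assoc, ← mul_assoc Uᴴ, hU, one_mul, hdd]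

end Perturbation

/-! ### Diagonal projections -/

section Indicator

variable {X : Type*} [MetricSpace X]

open Classical in
/-- Multiplication by the indicator function of `S`, as an operator on `ℓ²(X)`. -/
def indicOp (S : Set X) : ell2 X →L[ℂ] ell2 X :=
  weightedPerm (fun x => if x ∈ S then 1 else 0) 1
    (fun x => by split_ifs <;> simp) (Equiv.refl X)

omit [MetricSpace X] in
open Classical in
theorem ent_indicOp (S : Set X) (x y : X) :
    ent (indicOp S) x y = if x = y then if x ∈ S then 1 else 0 else 0 :=
  ent_weightedPerm _ _ _ _ x y

omit [MetricSpace X] in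
open Classical in
theorem indicOp_apply (S : Set X) (ξ : ell2 X) (x : X) :
    indicOp S ξ x = if x ∈ S then ξ x else 0 := by
  change (if x ∈ S then 1 else 0) * ξ x = _
  split_ifs <;> simp

theorem hasFinitePropagation_indicOp (S : Set X) : HasFinitePropagation (indicOp S) := by
  refine ⟨1, one_pos, fun x y hxy => ?_⟩
  rw [inner_basisVec_apply, ent_indicOp, if_neg]
  rintro rfl
  rw [dist_self] at hxy
  linarith

/-- Multiplication by the indicator function of `S`, as an element of the uniform Roe algebra. -/
def indic (S : Set X) : uniformRoe X :=
  ⟨indicOp S, (algebraicRoe X).le_topologicalClosure (hasFinitePropagation_indicOp S)⟩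

theorem star_indic (S : Set X) : star (indic S) = indic S := by
  classical
  refine Subtype.ext (ext_ent fun x y => ?_)
  change ent (star (indicOp S)) x y = ent (indicOp S) x y
  rw [ent_star, ent_indicOp, ent_indicOp]
  by_cases h : x = y
  · subst h; split_ifs <;> simp
  · rw [if_neg h, if_neg (Ne.symm h), star_zero]

theorem indic_mul_indic (S : Set X) : indic S * indic S = indic S := by
  refine Subtype.ext (ContinuousLinearMap.ext fun ξ => ?_)
  ext x
  change indicOp S (indicOp S ξ) x = indicOp S ξ x
  simp only [indicOp_apply]
  split_ifs <;> rfl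

variable {m n : Type*}

open Classical in
/-- The diagonal projection with the indicator functions of the sets `S i` on the diagonal. -/
def diagProj (S : n → Set X) : Matrix n n (uniformRoe X) := Matrix.diagonal fun i => indic (S i)

variable [Fintype m] [Fintype n]

theorem isStarProjection_diagProj (S : n → Set X) : IsStarProjection (diagProj S) := by
  classical
  refine ⟨?_, ?_⟩
  · rw [IsIdempotentElem, diagProj, Matrix.diagonal_mul_diagonal]
    simp only [indic_mul_indic]
  · rw [IsSelfAdjoint, diagProj, Matrix.star_eq_conjTranspose, Matrix.diagonal_conjTranspose]
    congr 1
    exact funext fun i => star_indic (S i)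

open Classical in
/-- The rank function of `diagProj S`. -/
def diagRank (S : n → Set X) (x : X) : ℕ := ∑ i, if x ∈ S i then 1 else 0

omit [Fintype m] [Fintype n] in
theorem fromBlocks_diagProj (S : m → Set X) (T : n → Set X) :
    Matrix.fromBlocks (diagProj S) 0 0 (diagProj T) = diagProj (Sum.elim S T) := by
  classical
  rw [diagProj, diagProj, diagProj, Matrix.fromBlocks_diagonal]
  congr 1
  · exact Subsingleton.elim _ _
  · ext i : 1
    cases i <;> rfl

omit [MetricSpace X] in
theorem diagRank_sumElim (S : m → Set X) (T : n → Set X) (x : X) :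
    diagRank (Sum.elim S T) x = diagRank S x + diagRank T x := by
  classical
  exact Fintype.sum_sum_type _

omit [MetricSpace X] in
theorem diagRank_le (S : n → Set X) (x : X) : diagRank S x ≤ Fintype.card n := by
  rw [diagRank, Fintype.card_eq_sum_ones]
  exact Finset.sum_le_sum fun i _ => by split_ifs <;> simp

end Indicator

/-! ### Equivalence of diagonal projections, block by block -/

section DiagonalBlocks

open Classical in
theorem isStarProjection_diagonal_ite {m : Type*} [Fintype m] (s : Finset m) :
    IsStarProjection (Matrix.diagonal fun a : m => if a ∈ s then (1 : ℂ) else 0) := by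
  refine ⟨?_, ?_⟩
  · simp [IsIdempotentElem, Matrix.diagonal_mul_diagonal]
  · rw [IsSelfAdjoint, Matrix.star_eq_conjTranspose, Matrix.diagonal_conjTranspose]
    congr 1
    ext a
    simp [apply_ite]

open Classical in
-- The witness is the coordinate restriction from `ℂ^m` to `ℂ^s`.
theorem mvN_diagonal_one {m : Type*} [Fintype m] (s : Finset m) :
    MvN (Matrix.diagonal fun a : m => if a ∈ s then (1 : ℂ) else 0) (1 : Matrix s s ℂ) := by
  refine ⟨(1 : Matrix m m ℂ).submatrix Subtype.val id, ?_, ?_⟩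
  · ext a b
    rw [Matrix.mul_apply, Matrix.diagonal_apply]
    simp only [Matrix.conjTranspose_apply, Matrix.submatrix_apply, Matrix.one_apply, id]
    rw [Finset.sum_coe_sort s fun k => star (if k = a then (1 : ℂ) else 0) *
      if k = b then (1 : ℂ) else 0]
    by_cases hab : a = b
    · subst hab
      simp
    · rw [if_neg hab]
      refine Finset.sum_eq_zero fun k _ => ?_
      by_cases hk : k = a
      · subst hk
        rw [if_neg hab, mul_zero]
      · rw [if_neg hk, star_zero, zero_mul]
  · ext a b
    rw [Matrix.mul_apply]
    simp only [Matrix.conjTranspose_apply, Matrix.submatrix_apply, Matrix.one_apply, id]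
    by_cases hab : a = b
    · subst hab
      simp
    · rw [if_neg hab]
      refine Finset.sum_eq_zero fun k _ => ?_
      by_cases hk : (b : m) = k
      · rw [if_neg fun h => hab (Subtype.ext (h.trans hk.symm)), zero_mul]
      · rw [if_neg hk, star_zero, mul_zero]

open Classical in
theorem mvN_diagonal_of_card_eq {m n : Type*} [Fintype m] [Fintype n] (s : Finset m)
    (t : Finset n) (h : s.card = t.card) :
    MvN (Matrix.diagonal fun a : m => if a ∈ s then (1 : ℂ) else 0)
      (Matrix.diagonal fun a : n => if a ∈ t then (1 : ℂ) else 0) := by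
  have e : s ≃ t := Finset.equivOfCardEq h
  have h1 : MvN (1 : Matrix s s ℂ) (1 : Matrix t t ℂ) := by
    have := MvN.reindex (IsStarProjection.one (Matrix s s ℂ)) e
    rwa [Matrix.reindex_apply, Matrix.submatrix_one_equiv] at this
  exact ((mvN_diagonal_one s).trans (isStarProjection_diagonal_ite s) (.one _) h1).trans
    (isStarProjection_diagonal_ite s) (isStarProjection_diagonal_ite t) (mvN_diagonal_one t).symm

variable {Γ : Type*} [Group Γ] [MetricSpace Γ] {m n : Type*} {H : Subgroup Γ}

theorem matBlockDiag_diagProj (S : n → Set Γ) : MatBlockDiag H (diagProj S) := by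
  classical
  intro i j
  by_cases hij : i = j
  · subst hij
    rw [diagProj, Matrix.diagonal_apply_eq]
    intro x y hxy
    change ent (indicOp (S i)) x y = 0
    rw [ent_indicOp, if_neg]
    rintro rfl
    exact hxy (by simp)
  · rw [diagProj, Matrix.diagonal_apply_ne _ hij]
    exact IsBlockDiag.zero H

open Classical in
/-- The diagonal positions of `diagProj S` in the coset `c H`. -/
def blockSupport (H : Subgroup Γ) [Fintype H] [Fintype n] (c : Γ) (S : n → Set Γ) :
    Finset (H × n) :=
  Finset.univ.filter fun a => c * a.1 ∈ S a.2

omit [MetricSpace Γ] in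
theorem mem_blockSupport [Fintype H] [Fintype n] {c : Γ} {S : n → Set Γ} {a : H × n} :
    a ∈ blockSupport H c S ↔ c * a.1 ∈ S a.2 := by
  simp [blockSupport]

omit [MetricSpace Γ] in
theorem card_blockSupport [Fintype H] [Fintype n] (c : Γ) (S : n → Set Γ) :
    (blockSupport H c S).card = ∑ g : H, diagRank S (c * g) := by
  classical
  rw [blockSupport, Finset.card_filter, Fintype.sum_prod_type]
  rfl

open Classical in
theorem blk_diagProj [Fintype H] [Fintype n] (c : Γ) (S : n → Set Γ) :
    blk H c (diagProj S) = Matrix.diagonal fun a => if a ∈ blockSupport H c S then 1 else 0 := by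
  ext ⟨g, i⟩ ⟨k, j⟩
  rw [Matrix.diagonal_apply, blk]
  by_cases hij : i = j
  · subst hij
    rw [diagProj, Matrix.diagonal_apply_eq]
    change ent (indicOp (S i)) _ _ = _
    rw [ent_indicOp]
    simp [mem_blockSupport]
  · rw [diagProj, Matrix.diagonal_apply_ne _ hij]
    simp [hij, ent_zero]

/-- Diagonal projections with the same rank in each coset of `H` are equivalent. -/
theorem mvN_diagProj_of_sum_eq [Fintype m] [Fintype n] [Fintype H]
    (hinv : ∀ g s t : Γ, dist (g * s) (g * t) = dist s t) {S : m → Set Γ} {T : n → Set Γ}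
    (h : ∀ c : Γ, ∑ g : H, diagRank S (c * g) = ∑ g : H, diagRank T (c * g)) :
    MvN (diagProj S) (diagProj T) := by
  classical
  refine mvN_of_blk (H := H) hinv (matBlockDiag_diagProj S) (matBlockDiag_diagProj T) fun c => ?_
  rw [blk_diagProj, blk_diagProj]
  convert mvN_diagonal_of_card_eq (blockSupport H c.out S) (blockSupport H c.out T) ?_
  rw [card_blockSupport, card_blockSupport, h]

end DiagonalBlocks

/-! ### Reducing projections to diagonal ones -/

section Diagonalization

variable {Γ : Type*} [Group Γ] [MetricSpace Γ] {n : Type*} [Fintype n]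

theorem isClosed_uniformRoe (X : Type*) [MetricSpace X] :
    IsClosed (uniformRoe X : Set (ell2 X →L[ℂ] ell2 X)) :=
  (algebraicRoe X).isClosed_topologicalClosure

/-- The uniform Roe algebra is a C⋆-algebra. -/
abbrev cstarAlgebraUniformRoe (X : Type*) [MetricSpace X] : CStarAlgebra (uniformRoe X) :=
  StarSubalgebra.cstarAlgebra _ (h_closed := isClosed_uniformRoe X)

/-- A block diagonal hermitian matrix is diagonalized by a block diagonal unitary. -/
theorem exists_unitary_blk_diagonal [DecidableEq n]
    (hinv : ∀ g s t : Γ, dist (g * s) (g * t) = dist s t)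
    {H : Subgroup Γ} [Fintype H] {a : Matrix n n (uniformRoe Γ)} (ha : MatBlockDiag H a)
    (hsa : aᴴ = a) :
    ∃ U : Matrix n n (uniformRoe Γ), MatBlockDiag H U ∧ Uᴴ * U = 1 ∧ U * Uᴴ = 1 ∧
      ∃ d : Γ → n → ℝ, ∀ i j x y, ent ((Uᴴ * a * U) i j : ell2 Γ →L[ℂ] ell2 Γ) x y =
        open Classical in if x = y ∧ i = j then (d x i : ℂ) else 0 := by
  classical
  have hherm : ∀ q : Γ ⧸ H, (blk H q.out a).IsHermitian := fun q => by
    rw [Matrix.IsHermitian, ← blk_conjTranspose, hsa]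
  -- The spectral theorem is applied on each coset separately. Entries of unitary matrices are
  -- bounded by 1, so the eigenvector matrices assemble whatever the blocks are.
  obtain ⟨U, hU, hUq⟩ := exists_blk_eq hinv
    (fun q => ((hherm q).eigenvectorUnitary : Matrix (H × n) (H × n) ℂ)) 1
    fun q _ _ => entry_norm_bound_of_unitary (hherm q).eigenvectorUnitary.2 _ _
  have hone : MatBlockDiag H (1 : Matrix n n (uniformRoe Γ)) := by
    convert matBlockDiag_one (H := H) (m := n)
  have hbone : ∀ c : Γ, blk H c (1 : Matrix n n (uniformRoe Γ)) = 1 := fun c => by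
    convert blk_one (H := H) (m := n) c
  have hD := (hU.conjTranspose.mul ha).mul hU
  refine ⟨U, hU, blk_ext (hU.conjTranspose.mul hU) hone fun q => ?_,
    blk_ext (hU.mul hU.conjTranspose) hone fun q => ?_,
    fun x i => (hherm (QuotientGroup.mk x)).eigenvalues (cosetCoord H x, i), fun i j x y => ?_⟩
  · rw [blk_mul hU.conjTranspose, blk_conjTranspose, hUq, hbone]
    exact Matrix.mem_unitaryGroup_iff'.1 (hherm q).eigenvectorUnitary.2
  · rw [blk_mul hU, blk_conjTranspose, hUq, hbone]
    exact Matrix.mem_unitaryGroup_iff.1 (hherm q).eigenvectorUnitary.2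
  · by_cases hxy : x⁻¹ * y ∈ H
    · have hq : (QuotientGroup.mk x : Γ ⧸ H) = QuotientGroup.mk y := QuotientGroup.eq.2 hxy
      have hblk : ∀ q : Γ ⧸ H, blk H q.out (Uᴴ * a * U) =
          Matrix.diagonal (RCLike.ofReal ∘ (hherm q).eigenvalues) := fun q => by
        rw [blk_mul (hU.conjTranspose.mul ha), blk_mul hU.conjTranspose, blk_conjTranspose, hUq,
          ← (hherm q).conjStarAlgAut_star_eigenvectorUnitary, Unitary.conjStarAlgAut_star_apply]
        rfl
      have h := congrFun (congrFun (hblk (QuotientGroup.mk x)) (cosetCoord H x, i))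
        (cosetCoord H y, j)
      rw [Matrix.diagonal_apply] at h
      simp only [blk] at h
      rw [out_mul_cosetCoord] at h
      nth_rewrite 1 [hq] at h
      rw [out_mul_cosetCoord] at h
      rw [h]
      have hiff : cosetCoord H x = cosetCoord H y ↔ x = y := by
        refine ⟨fun hc => ?_, fun h => by rw [h]⟩
        rw [← out_mul_cosetCoord H x, hc, hq, out_mul_cosetCoord]
      simp only [Prod.mk.injEq, hiff]
      rfl
    · rw [hD i j x y hxy, if_neg]
      rintro ⟨rfl, -⟩
      exact hxy (by simp)

/-- Every projection over the uniform Roe algebra is equivalent to a diagonal one. -/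
theorem exists_mvN_diagProj
    (hinv : ∀ g s t : Γ, dist (g * s) (g * t) = dist s t)
    (hproper : ∀ s : Set Γ, IsClosed s → Bornology.IsBounded s → s.Finite)
    {G : ℕ → Subgroup Γ} (hmono : Monotone G) (hunion : ∀ g : Γ, ∃ n, g ∈ G n)
    (hfin : ∀ n, Finite (G n)) {p : Matrix n n (uniformRoe Γ)} (hp : IsStarProjection p) :
    ∃ S : n → Set Γ, MvN p (diagProj S) := by
  classical
  let _ := cstarAlgebraUniformRoe Γ
  set N : ℝ := (Fintype.card n : ℝ) ^ 2 with hN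
  have hN0 : 0 ≤ N := by positivity
  -- The approximation costs `N * δ` and rounding the eigenvalues costs `N * (8 * (N * δ))`. This
  -- choice makes the total less than 1.
  set δ : ℝ := 1 / (10 * (N + 1) ^ 2) with hδ
  have hδ0 : 0 < δ := by positivity
  have hδ' : δ * (10 * (N + 1) ^ 2) = 1 := by rw [hδ]; field_simp
  obtain ⟨a₀, k, ha₀, hnear⟩ := exists_matBlockDiag_near hinv hproper hmono hunion p hδ0
  have := hfin k
  have := Fintype.ofFinite (G k)
  have hps : pᴴ = p := hp.isSelfAdjoint.star_eq
  -- Since `p` is self-adjoint, averaging `a₀` with its adjoint keeps the distance to `p` and makes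
  -- the spectral theorem applicable.
  set a : Matrix n n (uniformRoe Γ) := (1 / 2 : ℂ) • (a₀ + a₀ᴴ) with ha
  have haB : MatBlockDiag (G k) a := fun i j =>
    ((ha₀ i j).add (ha₀.conjTranspose i j)).smul (1 / 2 : ℂ)
  have hsa : aᴴ = a := by
    rw [ha, Matrix.conjTranspose_smul, Matrix.conjTranspose_add, Matrix.conjTranspose_conjTranspose,
      add_comm]
    simp
  have hpa : ∀ i j, ‖(p - a) i j‖ ≤ δ := by
    intro i j
    have h1 : (p - a) i j = (1 / 2 : ℂ) • ((p i j - a₀ i j) + star (p j i - a₀ j i)) := by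
      have h2 : star (p j i) = p i j := congrFun (congrFun hps i) j
      rw [star_sub, h2, Matrix.sub_apply]
      have h3 : p i j = (1 / 2 : ℂ) • (p i j + p i j) := by
        rw [← two_smul ℂ, smul_smul]; norm_num
      nth_rewrite 1 [h3]
      rw [ha, Matrix.smul_apply, ← smul_sub, Matrix.add_apply, Matrix.conjTranspose_apply]
      congr 1
      abel
    rw [h1, norm_smul]
    have h4 := norm_add_le (p i j - a₀ i j) (star (p j i - a₀ j i))
    rw [norm_star] at h4
    have h5 := hnear i j
    have h6 := hnear j i
    have h7 : ‖(1 / 2 : ℂ)‖ = 1 / 2 := by norm_num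
    rw [h7]
    linarith
  obtain ⟨U, hU, hU1, hU2, d, hd⟩ := exists_unitary_blk_diagonal hinv haB hsa
  have hdef := norm_conj_sq_sub_self_le hp hU1 hU2 (by nlinarith) hpa
  set D := Uᴴ * a * U with hDdef
  have hdsq : ∀ x i, |d x i ^ 2 - d x i| ≤ 4 * (N * δ) := by
    intro x i
    refine le_trans (le_of_eq ?_) ((norm_ent_le _ x x).trans (hdef i i))
    change _ = ‖ent (((D * D) i i : ell2 Γ →L[ℂ] ell2 Γ) - (D i i : ell2 Γ →L[ℂ] ell2 Γ)) x x‖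
    rw [coe_mul_apply, ent_sub, ent_sum, hd, if_pos ⟨rfl, rfl⟩, Finset.sum_eq_single i,
      ent_mul, tsum_eq_single x, hd, if_pos ⟨rfl, rfl⟩, ← Complex.ofReal_mul, ← Complex.ofReal_sub,
      Complex.norm_real, Real.norm_eq_abs, sq]
    · intro y hy
      rw [hd, if_neg fun h => hy h.1.symm, zero_mul]
    · intro j _ hj
      rw [ent_mul]
      refine (tsum_congr fun z => ?_).trans tsum_zero
      rw [hd, if_neg fun h => hj h.2.symm, zero_mul]
    · simp
  -- Round the eigenvalues at `1/2`. One of `|d x i|` and `|d x i - 1|` is at least `1/2` while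
  -- their product is at most `4 * (N * δ)`, so the other, which is the rounding error, is at most
  -- `8 * (N * δ)`.
  set S : n → Set Γ := fun i => {x | 1 / 2 < d x i} with hS
  refine ⟨S, ?_⟩
  refine mvN_of_conj_near (a := a) (δ := δ) (ε := 8 * (N * δ)) hp (isStarProjection_diagProj _)
    hU1 hU2 hpa (fun i j => ?_) (by nlinarith)
  refine norm_le_of_ent_diagonal (by positivity) (fun x y hxy => ?_) fun x => ?_
  · change ent ((D i j : ell2 Γ →L[ℂ] ell2 Γ) - (diagProj S i j : ell2 Γ →L[ℂ] ell2 Γ)) x y = 0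
    rw [ent_sub, hd, if_neg fun h => hxy h.1]
    rw [matBlockDiag_diagProj (H := ⊥), sub_zero]
    rw [Subgroup.mem_bot, inv_mul_eq_one]
    exact hxy
  · change ‖ent ((D i j : ell2 Γ →L[ℂ] ell2 Γ) - (diagProj S i j : ell2 Γ →L[ℂ] ell2 Γ)) x x‖ ≤ _
    rw [ent_sub, hd]
    by_cases hij : i = j
    · subst hij
      rw [if_pos ⟨rfl, rfl⟩, diagProj, Matrix.diagonal_apply_eq]
      change ‖(d x i : ℂ) - ent (indicOp _) x x‖ ≤ _
      rw [ent_indicOp, if_pos rfl]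
      have h1 := abs_le.1 (hdsq x i)
      by_cases hx : 1 / 2 < d x i
      · have hmem : x ∈ S i := hx
        rw [if_pos hmem, ← Complex.ofReal_one, ← Complex.ofReal_sub, Complex.norm_real,
          Real.norm_eq_abs, abs_le]
        constructor <;> nlinarith
      · have hmem : x ∉ S i := hx
        rw [if_neg hmem, sub_zero, Complex.norm_real, Real.norm_eq_abs, abs_le]
        rw [not_lt] at hx
        constructor <;> nlinarith
    · rw [if_neg fun h => hij h.2, diagProj, Matrix.diagonal_apply_ne _ hij]
      rw [ZeroMemClass.coe_zero, ent_zero, sub_zero, norm_zero]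
      positivity

end Diagonalization

/-! ### Equivalent diagonal projections have the same ranks on large blocks -/

section RankInvariance

/-- A matrix of operators on `E` acting on a tuple of vectors of `E`. -/
def matAct {X : Type*} [MetricSpace X] {m n : Type*} [Fintype n] (v : Matrix m n (uniformRoe X))
    (ξ : n → ell2 X) (i : m) : ell2 X := ∑ j, (v i j : ell2 X →L[ℂ] ell2 X) (ξ j)

variable {X : Type*} [MetricSpace X] {l m n : Type*} [Fintype m] [Fintype n]

theorem matAct_mul (v : Matrix l m (uniformRoe X)) (w : Matrix m n (uniformRoe X))
    (ξ : n → ell2 X) : matAct (v * w) ξ = matAct v (matAct w ξ) := by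
  funext i
  simp only [matAct, coe_mul_apply, map_sum, _root_.sum_apply]
  rw [Finset.sum_comm]
  rfl

omit [Fintype m] in
theorem matAct_sub (v w : Matrix m n (uniformRoe X)) (ξ : n → ell2 X) :
    matAct (v - w) ξ = matAct v ξ - matAct w ξ := by
  funext i
  simp only [matAct, Pi.sub_apply, ← Finset.sum_sub_distrib]
  rfl

theorem norm_matAct_le (v : Matrix m n (uniformRoe X)) (ξ : n → ell2 X) :
    ‖matAct v ξ‖ ≤ (∑ i, ∑ j, ‖v i j‖) * ‖ξ‖ := by
  refine (pi_norm_le_iff_of_nonneg (by positivity)).2 fun i => ?_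
  calc ‖matAct v ξ i‖ ≤ ∑ j, ‖v i j‖ * ‖ξ‖ := by
        refine norm_sum_le_of_le _ fun j _ => ?_
        refine ((v i j : ell2 X →L[ℂ] ell2 X).le_opNorm _).trans ?_
        exact mul_le_mul_of_nonneg_left (norm_le_pi_norm ξ j) (norm_nonneg _)
    _ = (∑ j, ‖v i j‖) * ‖ξ‖ := by rw [Finset.sum_mul]
    _ ≤ (∑ i, ∑ j, ‖v i j‖) * ‖ξ‖ := by
        gcongr
        exact Finset.single_le_sum (f := fun i => ∑ j, ‖v i j‖) (fun _ _ => by positivity)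
          (Finset.mem_univ i)

theorem matAct_diagProj (S : n → Set X) (ξ : n → ell2 X) (i : n) :
    matAct (diagProj S) ξ i = indicOp (S i) (ξ i) := by
  classical
  rw [matAct, Finset.sum_eq_single i]
  · rw [diagProj, Matrix.diagonal_apply_eq]
    rfl
  · intro j _ hj
    rw [diagProj, Matrix.diagonal_apply_ne _ hj.symm]
    rfl
  · simp

variable {Γ : Type*} [Group Γ] [MetricSpace Γ]

omit [MetricSpace Γ] in
theorem sum_smul_basisVec_apply {H : Subgroup Γ} [Fintype H] (c : Γ) (η : H → ℂ) (k : H) :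
    (∑ g : H, η g • (basisVec (c * g) : ell2 Γ)) (c * k) = η k := by
  classical
  rw [lp.coeFn_sum, Finset.sum_apply, Finset.sum_eq_single k]
  · simp [basisVec_apply]
  · intro g _ hg
    have : c * (k : Γ) ≠ c * g := fun h => hg (Subtype.ext (mul_left_cancel h).symm)
    simp [basisVec_apply, Subtype.ext_iff.not.1 hg.symm]
  · simp

/-- An equivalence in the uniform Roe algebra between diagonal projections cannot decrease the
rank on the cosets of large subgroups. -/
theorem exists_forall_sum_diagRank_le
    (hinv : ∀ g s t : Γ, dist (g * s) (g * t) = dist s t)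
    (hproper : ∀ s : Set Γ, IsClosed s → Bornology.IsBounded s → s.Finite)
    {G : ℕ → Subgroup Γ} (hmono : Monotone G) (hunion : ∀ g : Γ, ∃ n, g ∈ G n)
    [∀ k, Fintype (G k)] {S : m → Set Γ} {T : n → Set Γ} (h : MvN (diagProj S) (diagProj T)) :
    ∃ N, ∀ k ≥ N, ∀ c : Γ, ∑ g : G k, diagRank S (c * g) ≤ ∑ g : G k, diagRank T (c * g) := by
  classical
  obtain ⟨v, hv1, hv2⟩ := h
  -- `C` bounds the action of `vᴴ * diagProj T` times the number of entries of `v`. With `w` within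
  -- `1 / (C + 1)` of `v` in each entry, the matrix `vᴴ * diagProj T * (v - w)` is a strict
  -- contraction.
  set C : ℝ := (∑ i, ∑ j, ‖vᴴ i j‖) * (∑ i, ∑ j, ‖diagProj T i j‖) *
    (Fintype.card n * Fintype.card m) with hC
  have hC0 : 0 ≤ C := by positivity
  obtain ⟨w, N, hw, hnear⟩ := exists_matBlockDiag_near hinv hproper hmono hunion v
    (ε := 1 / (C + 1)) (by positivity)
  refine ⟨N, fun k hk c => ?_⟩
  replace hw := hw.mono (hmono hk)
  by_contra! hlt
  rw [← card_blockSupport, ← card_blockSupport] at hlt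
  set s := blockSupport (G k) c S
  set t := blockSupport (G k) c T
  -- Compress the block of `w` to the positions of `S` and `T` in the coset. If the rank of `S` were
  -- larger, `W` would have more columns than rows and hence a nonzero kernel vector `ζ`, extended
  -- by zero to the tuple `ξ` supported on the coset.
  let W : Matrix t s ℂ := fun a b => blk (G k) c w a b
  have hker : LinearMap.ker W.mulVecLin ≠ ⊥ := by
    refine LinearMap.ker_ne_bot_of_finrank_lt ?_
    simpa using hlt
  obtain ⟨ζ, hζ, hζ0⟩ := (Submodule.ne_bot_iff _).1 hker
  rw [LinearMap.mem_ker, Matrix.mulVecLin_apply] at hζ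
  let η : G k × m → ℂ := fun a => if ha : a ∈ s then ζ ⟨a, ha⟩ else 0
  let ξ : m → ell2 Γ := fun j => ∑ g : G k, η (g, j) • basisVec (c * g)
  have hξS : matAct (diagProj S) ξ = ξ := by
    funext j
    rw [matAct_diagProj, map_sum]
    refine Finset.sum_congr rfl fun g _ => ?_
    rw [map_smul]
    by_cases hg : (g, j) ∈ s
    · congr 1
      ext x
      rw [indicOp_apply, basisVec_apply]
      by_cases hx : x = c * g
      · subst hx
        rw [if_pos (mem_blockSupport.1 hg)]
      · simp [hx]
    · have : η (g, j) = 0 := dif_neg hg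
      rw [this, zero_smul, zero_smul]
  -- Inside the coset this is the kernel equation for `ζ`. Outside it, `w ξ` vanishes because `w` is
  -- block diagonal.
  have hwξ : matAct (diagProj T) (matAct w ξ) = 0 := by
    funext i
    rw [matAct_diagProj]
    ext z
    rw [indicOp_apply]
    split_ifs with hz
    swap
    · rfl
    have hval : matAct w ξ i z = ∑ j, ∑ g : G k, η (g, j) *
        ent (w i j : ell2 Γ →L[ℂ] ell2 Γ) z (c * g) := by
      rw [matAct, lp.coeFn_sum, Finset.sum_apply]
      refine Finset.sum_congr rfl fun j _ => ?_
      rw [map_sum, lp.coeFn_sum, Finset.sum_apply]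
      refine Finset.sum_congr rfl fun g _ => ?_
      rw [map_smul]
      rfl
    rw [hval]
    by_cases hzc : c⁻¹ * z ∈ G k
    · set h : G k := ⟨c⁻¹ * z, hzc⟩
      have hzh : z = c * h := by simp [h]
      rw [hzh] at hz ⊢
      have ht : (h, i) ∈ t := mem_blockSupport.2 hz
      have h0 := congrFun hζ ⟨(h, i), ht⟩
      rw [Matrix.mulVec, dotProduct] at h0
      rw [Finset.sum_comm, ← Fintype.sum_prod_type'
        (f := fun g j => η (g, j) * ent (w i j : ell2 Γ →L[ℂ] ell2 Γ) (c * h) (c * g))]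
      refine Eq.trans ?_ h0
      rw [← Finset.sum_subset (Finset.subset_univ s)]
      · rw [← Finset.sum_coe_sort]
        refine Finset.sum_congr rfl fun a _ => ?_
        have : η (a.1.1, a.1.2) = ζ a := dif_pos a.2
        rw [this, mul_comm]
        rfl
      · intro a _ ha
        have : η (a.1, a.2) = 0 := dif_neg ha
        rw [this, zero_mul]
    · refine Finset.sum_eq_zero fun j _ => Finset.sum_eq_zero fun g _ => ?_
      rw [hw i j, mul_zero]
      intro hmem
      refine hzc ?_
      have := (G k).mul_mem g.2 ((G k).inv_mem hmem)
      simpa [mul_assoc] using this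
  -- Since `vᴴ * diagProj T * v = diagProj S` fixes `ξ` while `diagProj T * w` kills it, `ξ` is
  -- fixed by the strict contraction above. This forces `ξ = 0`.
  have hfix : ξ = matAct vᴴ (matAct (diagProj T) (matAct (v - w) ξ)) := by
    have hSS : diagProj S * diagProj S = diagProj S :=
      (isStarProjection_diagProj S).isIdempotentElem.eq
    have hvv : vᴴ * diagProj T * v = diagProj S := by
      rw [← hv2, ← Matrix.mul_assoc, hv1, Matrix.mul_assoc, hv1, hSS]
    have h1 : matAct vᴴ (matAct (diagProj T) (matAct v ξ)) = ξ := by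
      rw [← matAct_mul, ← matAct_mul, hvv, hξS]
    have h2 : matAct (diagProj T) (matAct (v - w) ξ) = matAct (diagProj T) (matAct v ξ) := by
      rw [← sub_zero (matAct (diagProj T) (matAct v ξ)), ← hwξ, ← matAct_mul, ← matAct_mul,
        ← matAct_mul, Matrix.mul_sub, matAct_sub]
    rw [h2, h1]
  have hnorm : ‖ξ‖ ≤ C * (1 / (C + 1)) * ‖ξ‖ := by
    have h1 : ∑ i, ∑ j, ‖(v - w) i j‖ ≤ (Fintype.card n * Fintype.card m) * (1 / (C + 1)) := by
      refine (Finset.sum_le_sum fun i _ => Finset.sum_le_sum fun j _ => (hnear i j).le).trans_eq ?_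
      simp only [Finset.sum_const, Finset.card_univ, nsmul_eq_mul]
      ring
    calc ‖ξ‖ = ‖matAct vᴴ (matAct (diagProj T) (matAct (v - w) ξ))‖ := congrArg _ hfix
      _ ≤ (∑ i, ∑ j, ‖vᴴ i j‖) * ((∑ i, ∑ j, ‖diagProj T i j‖) *
          (((Fintype.card n * Fintype.card m) * (1 / (C + 1))) * ‖ξ‖)) := by
        refine (norm_matAct_le _ _).trans ?_
        gcongr
        refine (norm_matAct_le _ _).trans ?_
        gcongr
        refine (norm_matAct_le _ _).trans ?_
        gcongr
      _ = C * (1 / (C + 1)) * ‖ξ‖ := by rw [hC]; ring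
  have hξ0 : ξ = 0 := by
    rw [← norm_eq_zero]
    have h1 : C * (1 / (C + 1)) < 1 := by
      rw [mul_one_div, div_lt_one (by positivity)]
      linarith
    nlinarith [norm_nonneg ξ]
  refine hζ0 (funext fun a => ?_)
  have h1 := sum_smul_basisVec_apply c (fun g => η (g, a.1.2)) a.1.1
  have h2 : ξ a.1.2 = 0 := congrFun hξ0 _
  change (ξ a.1.2) _ = _ at h1
  rw [h2] at h1
  have h3 : η (a.1.1, a.1.2) = ζ a := dif_pos a.2
  rw [h3] at h1
  exact h1.symm

theorem exists_sum_diagRank_eq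
    (hinv : ∀ g s t : Γ, dist (g * s) (g * t) = dist s t)
    (hproper : ∀ s : Set Γ, IsClosed s → Bornology.IsBounded s → s.Finite)
    {G : ℕ → Subgroup Γ} (hmono : Monotone G) (hunion : ∀ g : Γ, ∃ n, g ∈ G n)
    [∀ k, Fintype (G k)] {S : m → Set Γ} {T : n → Set Γ} (h : MvN (diagProj S) (diagProj T)) :
    ∃ k, ∀ c : Γ, ∑ g : G k, diagRank S (c * g) = ∑ g : G k, diagRank T (c * g) := by
  obtain ⟨N, hN⟩ := exists_forall_sum_diagRank_le hinv hproper hmono hunion h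
  obtain ⟨M, hM⟩ := exists_forall_sum_diagRank_le hinv hproper hmono hunion h.symm
  exact ⟨max N M, fun c => le_antisymm (hN _ (le_max_left _ _) c) (hM _ (le_max_right _ _) c)⟩

end RankInvariance

/-! ### Enumerating a group so that cosets become intervals -/

section Enumeration

variable {Γ : Type*} [Group Γ]

/-- `d` numbers the cosets of `K` in `L`, and `r` divides by a representative of the coset.
Numbering `K` itself by 0 with representative 1 is what later makes the enumeration of `L` extend
that of `K`. Values outside `L` are irrelevant. -/
theorem exists_coset_index {K L : Subgroup Γ} (hKL : K ≤ L) [Finite L] :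
    ∃ (d : Γ → ℕ) (r : Γ → Γ), (∀ x ∈ L, (d x + 1) * Nat.card K ≤ Nat.card L) ∧
      (∀ x ∈ L, r x ∈ K) ∧ (∀ x ∈ K, d x = 0 ∧ r x = x) ∧
      (∀ x ∈ L, ∀ y ∈ L, d x = d y ↔ x⁻¹ * y ∈ K) ∧
      ∀ x ∈ L, ∀ y ∈ L, x⁻¹ * y ∈ K → (r x)⁻¹ * r y = x⁻¹ * y := by
  classical
  set Q := L ⧸ K.subgroupOf L
  have hpos : 0 < Nat.card Q := Nat.card_pos
  let f₀ : Q ≃ Fin (Nat.card Q) := Finite.equivFin Q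
  -- The swap gives the trivial coset the number 0.
  let f : Q ≃ Fin (Nat.card Q) := f₀.trans (Equiv.swap (f₀ (QuotientGroup.mk 1)) ⟨0, hpos⟩)
  have hf : f (QuotientGroup.mk 1) = ⟨0, hpos⟩ := Equiv.swap_apply_left _ _
  let rep : Q → L := fun q => if q = QuotientGroup.mk 1 then 1 else q.out
  have hrep : ∀ q, (QuotientGroup.mk (rep q) : Q) = q := fun q => by
    simp only [rep]
    split_ifs with h
    · exact h.symm
    · exact QuotientGroup.out_eq' q
  have hmk : ∀ (x : Γ) (hx : x ∈ L) (y : Γ) (hy : y ∈ L),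
      (QuotientGroup.mk ⟨x, hx⟩ : Q) = QuotientGroup.mk ⟨y, hy⟩ ↔ x⁻¹ * y ∈ K := by
    intro x hx y hy
    rw [QuotientGroup.eq, Subgroup.mem_subgroupOf]
    rfl
  have hcard : Nat.card L = Nat.card Q * Nat.card K := by
    rw [Subgroup.card_eq_card_quotient_mul_card_subgroup (K.subgroupOf L),
      Nat.card_congr (Subgroup.subgroupOfEquivOfLe hKL).toEquiv]
  have hone : ∀ (x : Γ) (hx : x ∈ K), (QuotientGroup.mk ⟨x, hKL hx⟩ : Q) = QuotientGroup.mk 1 :=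
    fun x hx => (hmk x (hKL hx) 1 L.one_mem).2 (by simpa using hx)
  let d : Γ → ℕ := fun x => if hx : x ∈ L then f (QuotientGroup.mk ⟨x, hx⟩) else 0
  let r : Γ → Γ := fun x => if hx : x ∈ L then (rep (QuotientGroup.mk ⟨x, hx⟩) : Γ)⁻¹ * x else 1
  have hd : ∀ x (hx : x ∈ L), d x = f (QuotientGroup.mk ⟨x, hx⟩) := fun x hx => dif_pos hx
  have hr : ∀ x (hx : x ∈ L), r x = (rep (QuotientGroup.mk ⟨x, hx⟩) : Γ)⁻¹ * x :=
    fun x hx => dif_pos hx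
  refine ⟨d, r, fun x hx => ?_, fun x hx => ?_, fun x hx => ?_, fun x hx y hy => ?_,
    fun x hx y hy hxy => ?_⟩
  · rw [hd x hx, hcard]
    exact Nat.mul_le_mul_right _ (f _).2
  · rw [hr x hx]
    exact (hmk _ (rep _).2 x hx).1 (hrep _)
  · rw [hd x (hKL hx), hr x (hKL hx), hone x hx, hf]
    simp [rep]
  · rw [hd x hx, hd y hy, Fin.val_inj, f.injective.eq_iff, hmk]
  · rw [hr x hx, hr y hy, (hmk x hx y hy).2 hxy]
    simp [mul_assoc]

/-- Mixed radix digits: as `k ∣ l`, the quotient of `a * l + s` by `k` is `a * (l / k) + s / k` with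
second term less than `l / k`, so it determines both `a` and `s / k`. -/
theorem mul_add_div_eq_iff {k l a b s t : ℕ} (hk : 0 < k) (hl : k ∣ l) (hs : s < l) (ht : t < l) :
    (a * l + s) / k = (b * l + t) / k ↔ a = b ∧ s / k = t / k := by
  obtain ⟨c, rfl⟩ := hl
  have e : ∀ a s, (a * (k * c) + s) / k = a * c + s / k := fun a s => by
    rw [show a * (k * c) + s = s + k * (a * c) by ring, Nat.add_mul_div_left _ _ hk, add_comm]
  have hs' : s / k < c := Nat.div_lt_of_lt_mul hs
  have ht' : t / k < c := Nat.div_lt_of_lt_mul ht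
  rw [e, e]
  constructor
  · intro h
    have hc : 0 < c := (Nat.zero_le _).trans_lt hs'
    have h1 : a = b := by
      have := congrArg (· / c) h
      simpa [mul_comm _ c, Nat.mul_add_div hc, Nat.div_eq_of_lt hs', Nat.div_eq_of_lt ht'] using this
    subst h1
    exact ⟨rfl, Nat.add_left_cancel h⟩
  · rintro ⟨rfl, h⟩
    rw [h]

/-- The index of `x` in the enumeration of the `n`-th subgroup, built from coset indices `d` and
remainders `r`. -/
def towerIndex (k : ℕ → ℕ) (d : ℕ → Γ → ℕ) (r : ℕ → Γ → Γ) : ℕ → Γ → ℕ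
  | 0, _ => 0
  | n + 1, x => d n x * k n + towerIndex k d r n (r n x)

/-- A group exhausted by finite subgroups can be enumerated so that the cosets of each of these
subgroups are the consecutive intervals of the corresponding length. -/
theorem exists_enumeration [Infinite Γ] (G : ℕ → Subgroup Γ) (hmono : Monotone G)
    (hzero : G 0 = ⊥) (hfin : ∀ n, Finite (G n)) (hunion : ∀ g : Γ, ∃ n, g ∈ G n) :
    ∃ e : Γ ≃ ℕ, ∀ n x y,
      e x / Nat.card (G n) = e y / Nat.card (G n) ↔ x⁻¹ * y ∈ G n := by
  classical
  choose d r hd hr hK hdiff hrem using fun n => exists_coset_index (hmono (Nat.le_succ n))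
  set k : ℕ → ℕ := fun n => Nat.card (G n)
  have hkpos : ∀ n, 0 < k n := fun n => Nat.card_pos
  set E := towerIndex k d r
  have hlt : ∀ n, ∀ x ∈ G n, E n x < k n := by
    intro n
    induction n with
    | zero => exact fun x _ => hkpos 0
    | succ n ih =>
      intro x hx
      have h1 := ih _ (hr n x hx)
      have h2 := hd n x hx
      change d n x * k n + E n (r n x) < k (n + 1)
      calc d n x * k n + E n (r n x) < (d n x + 1) * k n := by rw [add_mul, one_mul]; omega
        _ ≤ k (n + 1) := h2
  have hiff : ∀ n, ∀ m ≤ n, ∀ x ∈ G n, ∀ y ∈ G n,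
      E n x / k m = E n y / k m ↔ x⁻¹ * y ∈ G m := by
    intro n
    induction n with
    | zero =>
      intro m hm x hx y hy
      obtain rfl : m = 0 := by omega
      exact iff_of_true rfl ((G 0).mul_mem ((G 0).inv_mem hx) hy)
    | succ n ih =>
      intro m hm x hx y hy
      rcases hm.lt_or_eq with hm | rfl
      · have hmn : m ≤ n := by omega
        change (d n x * k n + E n (r n x)) / k m = (d n y * k n + E n (r n y)) / k m ↔ _
        rw [mul_add_div_eq_iff (hkpos m) (Subgroup.card_dvd_of_le (hmono hmn))
          (hlt n _ (hr n x hx)) (hlt n _ (hr n y hy)), hdiff n x hx y hy,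
          ih m hmn _ (hr n x hx) _ (hr n y hy)]
        constructor
        · rintro ⟨h1, h2⟩
          rwa [hrem n x hx y hy h1] at h2
        · intro h
          have h1 := hmono hmn h
          exact ⟨h1, by rwa [hrem n x hx y hy h1]⟩
      · rw [Nat.div_eq_of_lt (hlt _ x hx), Nat.div_eq_of_lt (hlt _ y hy)]
        exact iff_of_true rfl (mul_mem (inv_mem hx) hy)
  -- On the smaller subgroup the new digit is 0 and the remainder is the element itself, so the
  -- indices are stable and define one function on `Γ`.
  have hstep : ∀ n x, x ∈ G n → ∀ m, n ≤ m → E m x = E n x := by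
    intro n x hx m hm
    induction m, hm using Nat.le_induction with
    | base => rfl
    | succ m hm ih =>
      have h := hK m x (hmono hm hx)
      change d m x * k m + E m (r m x) = _
      rw [h.1, h.2, zero_mul, zero_add, ih]
  choose N hN using hunion
  let e : Γ → ℕ := fun x => E (N x) x
  have he : ∀ n x, x ∈ G n → e x = E n x := by
    intro n x hx
    rcases le_total n (N x) with h | h
    · exact hstep n x hx _ h
    · exact (hstep (N x) x (hN x) _ h).symm
  have heiff : ∀ n x y, e x / k n = e y / k n ↔ x⁻¹ * y ∈ G n := by
    intro n x y
    set M := max n (max (N x) (N y))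
    have hx : x ∈ G M := hmono ((le_max_left _ _).trans (le_max_right _ _)) (hN x)
    have hy : y ∈ G M := hmono ((le_max_right _ _).trans (le_max_right _ _)) (hN y)
    rw [he M x hx, he M y hy]
    exact hiff M n (le_max_left _ _) x hx y hy
  have hinj : Function.Injective e := by
    intro x y hxy
    -- Level 0 is the trivial subgroup, so its cosets are points.
    have := (heiff 0 x y).1 (by rw [hxy])
    rw [hzero, Subgroup.mem_bot, inv_mul_eq_one] at this
    exact this
  have hsurj : Function.Surjective e := by
    intro j
    -- As `Γ` is infinite, some `G n` has more than `j` elements. The index maps `G n` injectively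
    -- into the `k n` numbers below `k n`, hence onto them.
    obtain ⟨s, hs⟩ := Infinite.exists_subset_card_eq Γ (j + 1)
    obtain ⟨n, hn⟩ := (s.image N).bddAbove
    have hsub : (s : Set Γ) ⊆ G n := fun x hx =>
      hmono (hn (Finset.mem_coe.2 (Finset.mem_image_of_mem N hx))) (hN x)
    have hcard : j < k n := by
      have := Set.ncard_le_ncard hsub (Set.toFinite _)
      rw [Set.ncard_coe_finset, hs] at this
      exact this
    have := Fintype.ofFinite (G n)
    let F : G n → Fin (k n) := fun x => ⟨e x, by rw [he n x x.2]; exact hlt n x x.2⟩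
    have hF : Function.Injective F := fun x y h =>
      Subtype.ext (hinj (Fin.val_eq_of_eq h))
    have hbij : Function.Bijective F := (Fintype.bijective_iff_injective_and_card F).2
      ⟨hF, by rw [Fintype.card_fin]; exact Nat.card_eq_fintype_card.symm⟩
    obtain ⟨x, hx⟩ := hbij.2 ⟨j, hcard⟩
    exact ⟨x, Fin.val_eq_of_eq hx⟩
  exact ⟨Equiv.ofBijective e ⟨hinj, hsurj⟩, heiff⟩

/-- The sum over an interval of length `|G n|` is the sum over a coset of `G n`. -/
theorem sum_Ico_eq_sum_coset {M : Type*} [AddCommMonoid M] (H : Subgroup Γ) [Fintype H]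
    (e : Γ ≃ ℕ) (he : ∀ x y, e x / Nat.card H = e y / Nat.card H ↔ x⁻¹ * y ∈ H) (f : ℕ → M)
    (c : Γ) : ∑ i ∈ Finset.Ico (e c / Nat.card H * Nat.card H)
      ((e c / Nat.card H + 1) * Nat.card H), f i = ∑ g : H, f (e (c * g)) := by
  have hpos : 0 < Nat.card H := Nat.card_pos
  symm
  refine Finset.sum_bij (fun g _ => e (c * g)) ?_ ?_ ?_ fun _ _ => rfl
  · intro g _
    have h : e c / Nat.card H = e (c * g) / Nat.card H := (he _ _).2 (by simp)
    rw [Finset.mem_Ico, h]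
    exact ⟨Nat.div_mul_le_self _ _, by
      rw [mul_comm]; exact Nat.lt_mul_div_succ _ hpos⟩
  · intro g _ g' _ h
    exact Subtype.ext (mul_left_cancel (e.injective h))
  · intro i hi
    rw [Finset.mem_Ico] at hi
    have h : e c / Nat.card H = e (e.symm i) / Nat.card H := by
      rw [e.apply_symm_apply]
      exact (Nat.div_eq_of_lt_le hi.1 hi.2).symm
    exact ⟨⟨c⁻¹ * e.symm i, (he _ _).1 h⟩, Finset.mem_univ _, by simp⟩

end Enumeration

/-! ### Ranks of projections as bounded sequences -/

/-- An injective homomorphism from a monoid to a group whose differences exhaust the group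
identifies the group with the Grothendieck group. -/
theorem exists_grothendieckAddGroup_equiv {M Q : Type*} [AddCommMonoid M] [AddCommGroup Q]
    (ρ : M →+ Q) (hinj : Function.Injective ρ) (hsurj : ∀ q, ∃ a b, q = ρ a - ρ b) :
    ∃ φ : Algebra.GrothendieckAddGroup M ≃+ Q,
      ∀ m, φ (Algebra.GrothendieckAddGroup.of m) = ρ m := by
  have hof : ∀ m, Algebra.GrothendieckAddGroup.lift ρ (Algebra.GrothendieckAddGroup.of m) = ρ m :=
    fun m => DFunLike.congr_fun (Algebra.GrothendieckAddGroup.lift.symm_apply_apply ρ) m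
  have hdiff : ∀ x : Algebra.GrothendieckAddGroup M, ∃ a b,
      x = Algebra.GrothendieckAddGroup.of a - Algebra.GrothendieckAddGroup.of b := by
    intro x
    induction x using AddLocalization.ind with
    | H y =>
      refine ⟨y.1, y.2, ?_⟩
      change _ = (AddLocalization.addMonoidOf ⊤) y.1 - (AddLocalization.addMonoidOf ⊤) y.2.1
      rw [← AddLocalization.mk_zero_eq_addMonoidOf_mk, ← AddLocalization.mk_zero_eq_addMonoidOf_mk,
        Algebra.GrothendieckAddGroup.mk_sub_mk]
      simp
  refine ⟨AddEquiv.ofBijective (Algebra.GrothendieckAddGroup.lift ρ) ⟨?_, fun q => ?_⟩, hof⟩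
  · rw [injective_iff_map_eq_zero]
    intro x hx
    obtain ⟨a, b, rfl⟩ := hdiff x
    rw [map_sub, hof, hof, sub_eq_zero] at hx
    rw [hinj hx, sub_self]
  · obtain ⟨a, b, rfl⟩ := hsurj q
    exact ⟨Algebra.GrothendieckAddGroup.of a - Algebra.GrothendieckAddGroup.of b, by
      rw [map_sub, hof, hof]⟩

/-- The Murray-von Neumann class of a projection. -/
def VMonoid.cls {A : Type*} [Ring A] [StarRing A] {n : ℕ} (p : Matrix (Fin n) (Fin n) A)
    (hp : IsStarProjection p) : VMonoid A :=
  Quotient.mk (projSetoid A) ⟨n, p, hp⟩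

theorem K0.cls_eq {A : Type*} [Ring A] [StarRing A] {n : ℕ} (p : Matrix (Fin n) (Fin n) A)
    (hp : IsStarProjection p) :
    K0.cls p hp = Algebra.GrothendieckAddGroup.of (VMonoid.cls p hp) := rfl

section RankSeq

variable {Γ : Type*}

/-- The bounded sequence of ranks of `diagProj S` along an enumeration. -/
def rankSeq (e : Γ ≃ ℕ) {n : Type*} [Fintype n] (S : n → Set Γ) : BddSeq :=
  ⟨fun i => (diagRank S (e.symm i) : ℤ), memℓp_infty ⟨Fintype.card n, by
    rintro _ ⟨i, rfl⟩
    simpa using diagRank_le S (e.symm i)⟩⟩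

theorem rankSeq_apply (e : Γ ≃ ℕ) {n : Type*} [Fintype n] (S : n → Set Γ) (x : Γ) :
    rankSeq e S (e x) = diagRank S x := by
  change (diagRank S (e.symm (e x)) : ℤ) = _
  rw [e.symm_apply_apply]

/-- Layer-cake decomposition: a nonnegative integer at most `n` counts the `i < n` below it, so the
superlevel sets of `m` give the diagonal. -/
theorem exists_rankSeq_eq (e : Γ ≃ ℕ) (m : BddSeq) (hm : ∀ i, 0 ≤ m i) :
    ∃ (n : ℕ) (S : Fin n → Set Γ), rankSeq e S = m := by
  classical
  obtain ⟨C, hC⟩ := (memℓp_infty_iff.1 (lp.memℓp m) : BddAbove _)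
  obtain ⟨n, hn⟩ := exists_nat_ge C
  refine ⟨n, fun i => {x | (i : ℤ) < m (e x)}, ?_⟩
  ext i
  obtain ⟨x, rfl⟩ := e.surjective i
  rw [rankSeq_apply, diagRank]
  have h1 : m (e x) ≤ n := by
    have h2 : ‖m (e x)‖ ≤ C := hC ⟨e x, rfl⟩
    rw [Int.norm_eq_abs] at h2
    have h3 := (le_abs_self _).trans (h2.trans hn)
    exact_mod_cast h3
  obtain ⟨k, hk⟩ := Int.eq_ofNat_of_zero_le (hm (e x))
  rw [hk] at h1 ⊢
  have h1' : k ≤ n := Int.ofNat_le.1 h1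
  simp only [Set.mem_ofPred_eq, hk, Nat.cast_lt]
  rw [Fin.sum_univ_eq_sum_range (fun i => if i < k then 1 else 0) n, ← Finset.card_filter]
  have : (Finset.range n).filter (· < k) = Finset.range k := by
    ext a
    simp only [Finset.mem_filter, Finset.mem_range]
    omega
  rw [this, Finset.card_range]

variable [Group Γ]

/-- The intervals of length `|G n|` are the images of the cosets of `G n`, so `H_Γ` can be described
on the group itself. -/
theorem mem_HSub_iff {G : ℕ → Subgroup Γ} (hG : Monotone G) [∀ n, Fintype (G n)] {e : Γ ≃ ℕ}
    (he : ∀ n x y, e x / Nat.card (G n) = e y / Nat.card (G n) ↔ x⁻¹ * y ∈ G n) (m : BddSeq) :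
    m ∈ HSub G hG ↔ ∃ n, ∀ c : Γ, ∑ g : G n, m (e (c * g)) = 0 := by
  change m ∈ ⋃ n, (blockZero (Nat.card (G n)) : Set BddSeq) ↔ _
  rw [Set.mem_iUnion]
  refine exists_congr fun n => ⟨fun h c => ?_, fun h j => ?_⟩
  · rw [← sum_Ico_eq_sum_coset (G n) e (he n) (fun i => m i) c]
    exact h _
  · have := sum_Ico_eq_sum_coset (G n) e (he n) (fun i => m i) (e.symm (j * Nat.card (G n)))
    rw [h, e.apply_symm_apply, Nat.mul_div_cancel _ Nat.card_pos] at this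
    exact this

theorem mk_rankSeq_eq_iff {G : ℕ → Subgroup Γ} (hG : Monotone G) [∀ n, Fintype (G n)] {e : Γ ≃ ℕ}
    (he : ∀ n x y, e x / Nat.card (G n) = e y / Nat.card (G n) ↔ x⁻¹ * y ∈ G n)
    {m n : Type*} [Fintype m] [Fintype n] (S : m → Set Γ) (T : n → Set Γ) :
    (QuotientAddGroup.mk (rankSeq e S) : BddSeq ⧸ HSub G hG) = QuotientAddGroup.mk (rankSeq e T) ↔
      ∃ k, ∀ c : Γ, ∑ g : G k, diagRank S (c * g) = ∑ g : G k, diagRank T (c * g) := by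
  rw [QuotientAddGroup.eq, mem_HSub_iff hG he]
  refine exists_congr fun k => forall_congr' fun c => ?_
  simp only [lp.coeFn_add, lp.coeFn_neg, Pi.add_apply, Pi.neg_apply, rankSeq_apply,
    Finset.sum_add_distrib, Finset.sum_neg_distrib]
  rw [neg_add_eq_zero]
  exact_mod_cast Iff.rfl

variable [MetricSpace Γ]

/-- The class of the rank sequence modulo `H_Γ` is a complete invariant. One direction is the
dimension count, the other the blockwise construction. -/
theorem mvN_diagProj_iff (hinv : ∀ g s t : Γ, dist (g * s) (g * t) = dist s t)
    (hproper : ∀ s : Set Γ, IsClosed s → Bornology.IsBounded s → s.Finite)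
    {G : ℕ → Subgroup Γ} (hG : Monotone G) (hunion : ∀ g : Γ, ∃ n, g ∈ G n)
    [∀ n, Fintype (G n)] {e : Γ ≃ ℕ}
    (he : ∀ n x y, e x / Nat.card (G n) = e y / Nat.card (G n) ↔ x⁻¹ * y ∈ G n)
    {m n : Type*} [Fintype m] [Fintype n] (S : m → Set Γ) (T : n → Set Γ) :
    MvN (diagProj S) (diagProj T) ↔
      (QuotientAddGroup.mk (rankSeq e S) : BddSeq ⧸ HSub G hG) =
        QuotientAddGroup.mk (rankSeq e T) := by
  rw [mk_rankSeq_eq_iff hG he]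
  refine ⟨exists_sum_diagRank_eq hinv hproper hG hunion, ?_⟩
  rintro ⟨k, hk⟩
  exact mvN_diagProj_of_sum_eq (H := G k) hinv hk

/-- The rank homomorphism on Murray-von Neumann classes. -/
theorem exists_rank_hom (hinv : ∀ g s t : Γ, dist (g * s) (g * t) = dist s t)
    (hproper : ∀ s : Set Γ, IsClosed s → Bornology.IsBounded s → s.Finite)
    {G : ℕ → Subgroup Γ} (hG : Monotone G) (hunion : ∀ g : Γ, ∃ n, g ∈ G n)
    [∀ n, Fintype (G n)] {e : Γ ≃ ℕ}
    (he : ∀ n x y, e x / Nat.card (G n) = e y / Nat.card (G n) ↔ x⁻¹ * y ∈ G n) :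
    ∃ ρ : VMonoid (uniformRoe Γ) →+ (BddSeq ⧸ HSub G hG), Function.Injective ρ ∧
      (∀ (n : ℕ) (S : Fin n → Set Γ),
        ρ (VMonoid.cls (diagProj S) (isStarProjection_diagProj S)) = QuotientAddGroup.mk (rankSeq e S)) ∧
      ∀ x, ∃ (n : ℕ) (S : Fin n → Set Γ),
        x = VMonoid.cls (diagProj S) (isStarProjection_diagProj S) := by
  choose D hD using fun p : ProjMat (uniformRoe Γ) =>
    exists_mvN_diagProj hinv hproper hG hunion (fun n => Finite.of_fintype (G n)) p.2.2
  -- The rank class does not depend on which equivalent diagonal projection is chosen.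
  -- Well-definedness and additivity both follow from this.
  have hrk : ∀ (p : ProjMat (uniformRoe Γ)) {n : Type} [Fintype n] (S : n → Set Γ),
      MvN p.2.1 (diagProj S) → (QuotientAddGroup.mk (rankSeq e (D p)) : BddSeq ⧸ HSub G hG) =
        QuotientAddGroup.mk (rankSeq e S) := fun p n _ S h =>
    (mvN_diagProj_iff hinv hproper hG hunion he _ _).1
      ((hD p).symm.trans (isStarProjection_diagProj _) (isStarProjection_diagProj _) h)
  let ρ : VMonoid (uniformRoe Γ) →+ (BddSeq ⧸ HSub G hG) :=
    { toFun := Quotient.lift (fun p => QuotientAddGroup.mk (rankSeq e (D p))) fun p q h =>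
        hrk p (D q) (MvN.trans p.2.2 (isStarProjection_diagProj _) h (hD q))
      map_zero' := by
        change (QuotientAddGroup.mk (rankSeq e (D ProjMat.zero)) : BddSeq ⧸ HSub G hG) = _
        rw [hrk ProjMat.zero (fun _ : Fin 0 => ∅)
          ⟨0, Matrix.ext fun i => i.elim0, Matrix.ext fun i => i.elim0⟩]
        rw [QuotientAddGroup.eq_zero_iff, mem_HSub_iff hG he]
        exact ⟨0, fun c => Finset.sum_eq_zero fun g _ => by rw [rankSeq_apply]; rfl⟩
      map_add' := by
        rintro ⟨p⟩ ⟨q⟩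
        change (QuotientAddGroup.mk (rankSeq e (D (p.sum q))) : BddSeq ⧸ HSub G hG) =
          QuotientAddGroup.mk (rankSeq e (D p)) + QuotientAddGroup.mk (rankSeq e (D q))
        have h : MvN (p.sum q).2.1 (diagProj (Sum.elim (D p) (D q))) := by
          rw [← fromBlocks_diagProj]
          exact MvN.trans (p.sum q).2.2
            (isStarProjection_fromBlocks (isStarProjection_diagProj _) (isStarProjection_diagProj _))
            (p.sum_mvN q).symm (MvN.fromBlocks (hD p) (hD q))
        rw [hrk _ _ h, ← QuotientAddGroup.mk_add]
        congr 1
        ext i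
        change (diagRank _ _ : ℤ) = diagRank _ _ + diagRank _ _
        rw [diagRank_sumElim]
        push_cast
        rfl }
  refine ⟨ρ, ?_, fun n S => hrk _ S (MvN.refl (isStarProjection_diagProj S)), ?_⟩
  · rintro ⟨p⟩ ⟨q⟩ h
    exact Quotient.sound (MvN.trans p.2.2 q.2.2 (hD p) (MvN.trans (isStarProjection_diagProj _)
      q.2.2 ((mvN_diagProj_iff hinv hproper hG hunion he _ _).2 h) (hD q).symm))
  · rintro ⟨p⟩
    exact ⟨p.1, D p, Quotient.sound (hD p)⟩

end RankSeq

end RoeK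

end

/-! ### The ordered isomorphism -/

theorem theorem4p8 {Γ : Type*} [Group Γ] [Countable Γ] [Infinite Γ]
    -- `Γ` is locally finite
    (hlf : ∀ S : Subgroup Γ, S.FG → Finite S)
    -- a proper left-invariant metric on `Γ`
    [MetricSpace Γ]
    (hinv : ∀ g s t : Γ, dist (g * s) (g * t) = dist s t)
    (hproper : ∀ s : Set Γ, IsClosed s → Bornology.IsBounded s → s.Finite)
    -- an increasing sequence of finite subgroups exhausting `Γ`
    (G : ℕ → Subgroup Γ) (hmono : Monotone G) (hzero : G 0 = ⊥)
    (hfin : ∀ n, Finite (G n)) (hunion : ∀ g : Γ, ∃ n, g ∈ G n) :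
    ∃ φ : RoeK.K0 (RoeK.uniformRoe Γ) ≃+ (RoeK.BddSeq ⧸ RoeK.HSub G hmono),
      φ '' RoeK.K0.pos (RoeK.uniformRoe Γ) =
        QuotientAddGroup.mk '' {m : RoeK.BddSeq | ∀ i : ℕ, 0 ≤ m i} ∧
      φ (RoeK.K0.unit (RoeK.uniformRoe Γ)) = QuotientAddGroup.mk (1 : RoeK.BddSeq) := by
  have := fun n => Fintype.ofFinite (G n)
  obtain ⟨e, he⟩ := RoeK.exists_enumeration G hmono hzero hfin hunion
  obtain ⟨ρ, hinj, hρ, hdiag⟩ := RoeK.exists_rank_hom hinv hproper hmono hunion he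
  have hpos : ∀ m : RoeK.BddSeq, (∀ i, 0 ≤ m i) → ∃ a, ρ a = QuotientAddGroup.mk m := by
    intro m hm
    obtain ⟨n, S, hS⟩ := RoeK.exists_rankSeq_eq e m hm
    exact ⟨RoeK.VMonoid.cls _ (RoeK.isStarProjection_diagProj S), by rw [hρ n S, hS]⟩
  obtain ⟨φ, hφ⟩ := RoeK.exists_grothendieckAddGroup_equiv ρ hinj (by
    intro q
    obtain ⟨m, rfl⟩ := QuotientAddGroup.mk_surjective q
    obtain ⟨C, hC⟩ := (memℓp_infty_iff.1 (lp.memℓp m) : BddAbove _)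
    -- Write `m = m⁺ - (m⁺ - m)`, a difference of nonnegative bounded sequences, each of which is a
    -- rank sequence.
    have hmem : Memℓp (fun i => max (m i) 0 : ℕ → ℤ) ∞ := memℓp_infty ⟨C, by
      rintro _ ⟨i, rfl⟩
      refine le_trans ?_ (hC ⟨i, rfl⟩)
      change ‖max (m i) 0‖ ≤ ‖m i‖
      rw [Int.norm_eq_abs, Int.norm_eq_abs]
      exact_mod_cast abs_max_le_max_abs_abs.trans (by simp)⟩
    let mp : RoeK.BddSeq := ⟨_, hmem⟩
    obtain ⟨a, ha⟩ := hpos mp fun i => le_max_right _ _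
    obtain ⟨b, hb⟩ := hpos (mp - m) fun i => sub_nonneg.2 (le_max_left _ _)
    exact ⟨a, b, by rw [ha, hb, ← QuotientAddGroup.mk_sub, sub_sub_cancel]⟩)
  refine ⟨φ, ?_, ?_⟩
  · ext q
    constructor
    · rintro ⟨_, ⟨n, p, hp, rfl⟩, rfl⟩
      obtain ⟨k, S, hS⟩ := hdiag (RoeK.VMonoid.cls p hp)
      refine ⟨RoeK.rankSeq e S, fun i => Int.natCast_nonneg _, ?_⟩
      rw [RoeK.K0.cls_eq, hφ, hS, hρ]
    · rintro ⟨m, hm, rfl⟩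
      obtain ⟨n, S, hS⟩ := RoeK.exists_rankSeq_eq e m hm
      exact ⟨_, ⟨n, RoeK.diagProj S, RoeK.isStarProjection_diagProj S, rfl⟩, by
        rw [RoeK.K0.cls_eq, hφ, hρ, hS]⟩
  -- The unit is the diagonal projection of the whole group, of constant rank 1.
  · have hone : RoeK.diagProj (fun _ : Fin 1 => (Set.univ : Set Γ)) = 1 := by
      ext1 i j
      obtain rfl : i = j := Subsingleton.elim _ _
      rw [Matrix.one_apply_eq, RoeK.diagProj]
      refine Eq.trans (@Matrix.diagonal_apply_eq _ _ (Classical.decEq _) _ _ i) ?_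
      refine Subtype.ext (ContinuousLinearMap.ext fun ξ => ?_)
      ext x
      change RoeK.indicOp Set.univ ξ x = ξ x
      rw [RoeK.indicOp_apply, if_pos (Set.mem_univ x)]
    have hrank : RoeK.rankSeq e (fun _ : Fin 1 => (Set.univ : Set Γ)) = 1 := by
      ext i
      change (RoeK.diagRank _ _ : ℤ) = 1
      simp [RoeK.diagRank]
    rw [← hrank, ← hρ, RoeK.K0.unit, RoeK.K0.cls_eq, hφ]
    simp only [hone]
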